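/- **Setting.** For every $N\ge 1$ let $W_N$ be a random real symmetric $N\times N$ matrix whose entries $(W_N)_{jk}$, $1\le j\le k\le N$, are independent, with $$\mathbb E (W_N)_{jk}=0,\quad \mathbb V (W_N)_{jk}=\sigma^2,\quad \mathbb E (W_N)_{jk}^4\le m_4<\infty\qquad (j\ne k),$$ $$\mathbb E (W_N)_{jj}=0,\quad \mathbb E (W_N)_{jj}^2\le\sigma_1^2<\infty ,$$ where $\sigma,\sigma_1,m_4$ do not depend on $N,j,k$ (such a sequence is called a real symmetric Wigner matrix with parameter $\sigma$). Let $m$ be a positive integer such that for all $1\le i\le m$ and all $\epsilon>0$ $$\frac1N\sum_{j:\,j\ne i}\mathbb E\Big(|(W_N)_{ij}|^4\,\mathbf 1_{\{|(W_N)_{ij}|\ge \epsilon N^{1/4}\}}\Big)\longrightarrow 0\qquad (N\to\infty).\tag{$A_1$}$$ **Proposition.** There is a polynomial $P_4$ of degree $4$ with positive coefficients (a universal one), and for all $\sigma,\sigma_1,m_4$ there is a constant $C>0$ depending only on $\sigma,\sigma_1,m_4$, such that the following holds for every $m$ and every $(W_N)$ as above. After enlarging the probability spaces if necessary, there exist a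 random real symmetric Wigner matrix $T_N$ with the same parameter $\sigma$ (on the same probability space as $W_N$), and non-random $\epsilon_N>0$ with $\epsilon_N\to 0$, such that 1. $(T_N)_{jk}=(W_N)_{jk}$ for $m+1\le j,k\le N$; 2. $\mathbb P\big((T_N)_{ik}=(W_N)_{ik}\ \text{for all}\ 1\le i\le m,\ 1\le k\le N\big)\to 1$ as $N\to\infty$; 3. $\mathbb E (T_N)_{ik}=0$ for $1\le i\le m$, $1\le k\le N$; 4. $\mathbb V (T_N)_{ik}=\sigma^2$ for $1\le i\le m$, $1\le k\le N$, $i\neq k$, and $\sup_{1\le i\le m,\,N}\mathbb V (T_N)_{ii}<\infty$; 5. $\sup_{N,\ 1\le i\le m,\ 1\le k\le N,\ k\ne i}\mathbb E (T_N)_{ik}^4<\infty$; 6. $|(T_N)_{ik}|\le \epsilon_N N^{1/4}$ for $1\le i\le m$, $1\le k\le N$; and, with $G_N(z)=\big(zI_N-\tfrac1{\sqrt N}T_N\big)^{-1}$, with $\|\cdot\|$ the operator norm for the Euclidean norm on $\mathbb C^N$, and with $\mathbb V\xi=\mathbb E|\xi-\mathbb E\xi|^2$ for complex $\xi$, $$\mathbb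 V\big[(G_N(z))_{ij}\big]\le C\,\frac{\mathbb E\|G_N(z)\|^2\;P_4(|\Im z|^{-1})}{N}+C\,\frac{\mathbb E\|G_N(z)\|^{3/2}\;P_4(|\Im z|^{-1})}{N}$$ for all $N\ge1$, all $z\in\mathbb C\setminus\mathbb R$, all $1\le i\le m$ with $i\le N$, and all $1\le j\le N$. -/

import Mathlib

open MeasureTheory ProbabilityTheory Filter Topology

universe u

namespace WignerResolvent

/-- The sequence `W N`, `N = 0, 1, 2, …`, consists of random real symmetric Wigner matrices
(before normalization); `W N` is an `N × N` matrix on its own probability space `(Ω N, P N)`.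
The entries on and above the diagonal are independent; the off-diagonal ones are centred, with
variance `σ ^ 2` and fourth moments at most `m₄`; the diagonal ones are centred, with second
moments at most `σ₁ ^ 2`. The bounds `m₄`, `σ₁` are uniform in `N` and in the entry, so they are
finite upper bounds of the suprema of these moments. -/
structure IsWigner {Ω : ℕ → Type u} [∀ N, MeasurableSpace (Ω N)] (P : ∀ N, Measure (Ω N))
    (W : ∀ N, Ω N → Matrix (Fin N) (Fin N) ℝ) (σ σ₁ m₄ : ℝ) : Prop where
  measurable_entry : ∀ (N : ℕ) (j k : Fin N), Measurable fun ω => W N ω j k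
  isSymm : ∀ (N : ℕ) (ω : Ω N), (W N ω).IsSymm
  indep : ∀ N : ℕ,
    iIndepFun (fun (p : {p : Fin N × Fin N // p.1 ≤ p.2}) ω => W N ω p.1.1 p.1.2) (P N)
  offDiag_memLp : ∀ (N : ℕ) (j k : Fin N), j ≠ k → MemLp (fun ω => W N ω j k) 4 (P N)
  offDiag_mean : ∀ (N : ℕ) (j k : Fin N), j ≠ k → ∫ ω, W N ω j k ∂(P N) = 0
  offDiag_variance : ∀ (N : ℕ) (j k : Fin N), j ≠ k →
    variance (fun ω => W N ω j k) (P N) = σ ^ 2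
  offDiag_fourth : ∀ (N : ℕ) (j k : Fin N), j ≠ k → ∫ ω, (W N ω j k) ^ 4 ∂(P N) ≤ m₄
  diag_memLp : ∀ (N : ℕ) (j : Fin N), MemLp (fun ω => W N ω j j) 2 (P N)
  diag_mean : ∀ (N : ℕ) (j : Fin N), ∫ ω, W N ω j j ∂(P N) = 0
  diag_second : ∀ (N : ℕ) (j : Fin N), ∫ ω, (W N ω j j) ^ 2 ∂(P N) ≤ σ₁ ^ 2

/-- The Lindeberg functional of row `i` (rows are numbered from `0`):
`N⁻¹ ∑_{j ≠ i} E (|W i j| ^ 4 ; |W i j| ≥ ε N ^ (1/4))`.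
It is set to `0` for the finitely many `N` for which row `i` does not exist. -/
noncomputable def rowLindeberg {Ω : ℕ → Type u} [∀ N, MeasurableSpace (Ω N)]
    (P : ∀ N, Measure (Ω N)) (W : ∀ N, Ω N → Matrix (Fin N) (Fin N) ℝ)
    (i : ℕ) (ε : ℝ) (N : ℕ) : ℝ :=
  if h : i < N then
    (1 / (N : ℝ)) * ∑ j ∈ Finset.univ.erase (⟨i, h⟩ : Fin N),
      ∫ ω in {ω | ε * (N : ℝ) ^ (1 / 4 : ℝ) ≤ |W N ω ⟨i, h⟩ j|}, |W N ω ⟨i, h⟩ j| ^ 4 ∂(P N)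
  else 0

/-- `T` is a modification of the Wigner matrices `W` in the first `m` rows and columns, with
truncation levels `ε N * N ^ (1/4)`. Both sequences live on the same probability spaces. -/
structure IsRowTruncation {Ω : ℕ → Type u} [∀ N, MeasurableSpace (Ω N)] (P : ∀ N, Measure (Ω N))
    (W T : ∀ N, Ω N → Matrix (Fin N) (Fin N) ℝ) (σ : ℝ) (m : ℕ) (ε : ℕ → ℝ) : Prop where
  isWigner : ∃ σ₁ m₄ : ℝ, IsWigner P T σ σ₁ m₄
  eps_pos : ∀ N, 0 < ε N
  eps_tendsto : Tendsto ε atTop (𝓝 0)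
  eq_of_ge : ∀ (N : ℕ) (ω : Ω N) (j k : Fin N), m ≤ (j : ℕ) → m ≤ (k : ℕ) →
    T N ω j k = W N ω j k
  tendsto_prob : Tendsto
    (fun N => P N {ω | ∀ i k : Fin N, (i : ℕ) < m → T N ω i k = W N ω i k}) atTop (𝓝 1)
  mean : ∀ (N : ℕ) (i k : Fin N), (i : ℕ) < m → ∫ ω, T N ω i k ∂(P N) = 0
  variance_offDiag : ∀ (N : ℕ) (i k : Fin N), (i : ℕ) < m → i ≠ k →
    variance (fun ω => T N ω i k) (P N) = σ ^ 2
  variance_diag : ∃ c : ℝ, ∀ (N : ℕ) (i : Fin N), (i : ℕ) < m →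
    variance (fun ω => T N ω i i) (P N) ≤ c
  fourth_offDiag : ∃ c : ℝ, ∀ (N : ℕ) (i k : Fin N), (i : ℕ) < m → i ≠ k →
    ∫ ω, (T N ω i k) ^ 4 ∂(P N) ≤ c
  abs_le : ∀ (N : ℕ) (ω : Ω N) (i k : Fin N), (i : ℕ) < m →
    |T N ω i k| ≤ ε N * (N : ℝ) ^ (1 / 4 : ℝ)

/-- The resolvent `(z I - N^{-1/2} A)⁻¹` of the normalized matrix `N^{-1/2} A`. -/
noncomputable def resolventMatrix {N : ℕ} (A : Matrix (Fin N) (Fin N) ℝ) (z : ℂ) :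
    Matrix (Fin N) (Fin N) ℂ :=
  (z • (1 : Matrix (Fin N) (Fin N) ℂ) - (((1 / Real.sqrt N) • A).map fun x : ℝ => (x : ℂ)))⁻¹

/-- The operator norm of a complex matrix for the Euclidean norm on `ℂ ^ N`. -/
noncomputable def opNorm {N : ℕ} (A : Matrix (Fin N) (Fin N) ℂ) : ℝ :=
  ‖Matrix.toEuclideanCLM (n := Fin N) (𝕜 := ℂ) A‖

/-- The variance `E |ξ - E ξ| ^ 2` of a complex random variable. -/
noncomputable def cVariance {Ω : Type u} [MeasurableSpace Ω] (P : Measure Ω) (ξ : Ω → ℂ) : ℝ :=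
  ∫ ω, ‖ξ ω - ∫ ω', ξ ω' ∂P‖ ^ 2 ∂P

end WignerResolvent

/-
The truncation of the first `m` rows keeps an entry `x` with `|x| < L`, where
`L = ε_N N ^ (1 / 4)`, and sends the others to `0`, except that with probability
`q = E[x ^ 2; |x| ≥ L] / L ^ 2`, independently of `x`, it puts `± y` instead. The choice
`y ^ 2 = L ^ 2 + E[x ^ 2; |x| < L]` preserves the variance exactly, and the sign is biased so that
the mean stays zero. The new entries are at most `2 L`, and the fourth moment grows at most by the
factor `4`. An entry changes with probability at most `2 E[x ^ 4; |x| ≥ L] / L ^ 4`, so the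
Lindeberg condition along levels `ε_N` that decrease slowly makes the total probability of a
change in the first `m` rows tend to zero.

For the variance bound, the Efron–Stein inequality bounds the variance of `G i j` by the sum over
the entries of the influences `E |G i j - G⁰ i j| ^ 2`, where `G⁰` is the resolvent with that
entry set to zero. By the resolvent identity, `G i j - G⁰ i j` equals a multiple of the entry
times products `G⁰ i k * G⁰ l j`, up to a second-order term that costs a fourth moment. As `G⁰` is
independent of the entry, moments of the entry factor out, and the same identity then turns `G⁰`
back into `G`. Summing over all `k, l` with `∑ k, |G i k| ^ 2 ≤ ‖G‖ ^ 2` gives the bound; on the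
diagonal, where no fourth moment is available, there are only `N` entries and the cruder
`E |G i j - G⁰ i j| ^ 2 ≲ (E |G i k| ^ 2) / N` is enough. If `N ≲ |Im z| ^ (-2)`, the trivial
bound `|G i j| ≤ ‖G‖` suffices.
-/

namespace WignerResolvent

section Resolvent

theorem abs_im_mul_norm_le_norm_smul_sub {E : Type*} [NormedAddCommGroup E]
    [InnerProductSpace ℂ E] {A : E →ₗ[ℂ] E} (hA : A.IsSymmetric) (z : ℂ) (v : E) :
    |z.im| * ‖v‖ ≤ ‖z • v - A v‖ := by
  have him : (inner ℂ v (z • v - A v)).im = z.im * ‖v‖ ^ 2 := by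
    have hreal : (inner ℂ v (A v)).im = 0 := hA.im_inner_self_apply v
    rw [inner_sub_right, inner_smul_right, Complex.sub_im, hreal, inner_self_eq_norm_sq_to_K,
      sub_zero]
    simp [← Complex.ofReal_pow]
  have hmul : ‖v‖ * (|z.im| * ‖v‖) ≤ ‖v‖ * ‖z • v - A v‖ :=
    calc ‖v‖ * (|z.im| * ‖v‖) = |(inner ℂ v (z • v - A v)).im| := by
          rw [him, abs_mul, abs_of_nonneg (sq_nonneg ‖v‖)]
          ring
      _ ≤ ‖v‖ * ‖z • v - A v‖ := (Complex.abs_im_le_norm _).trans (norm_inner_le_norm _ _)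
  rcases eq_or_ne v 0 with rfl | hv
  · simp
  · exact le_of_mul_le_mul_left hmul (norm_pos_iff.mpr hv)

theorem isUnit_smul_one_sub_of_isHermitian {n : Type*} [Fintype n] [DecidableEq n]
    {B : Matrix n n ℂ} (hB : B.IsHermitian) {z : ℂ} (hz : z.im ≠ 0) :
    IsUnit (z • (1 : Matrix n n ℂ) - B) := by
  let φ := Matrix.toEuclideanCLM (n := n) (𝕜 := ℂ)
  have hsa : IsSelfAdjoint (φ B) := IsSelfAdjoint.map (x := B) hB φ
  have hz' : z ∉ spectrum ℂ B := fun h =>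
    hz (Complex.conj_eq_iff_im.mp (Complex.conj_eq_iff_re.mpr
      (hsa.mem_spectrum_eq_re (by rwa [AlgEquiv.spectrum_eq φ])).symm))
  rwa [spectrum.notMem_iff, Algebra.algebraMap_eq_smul_one] at hz'

variable {N : ℕ} {A B : Matrix (Fin N) (Fin N) ℝ} {z : ℂ}

/-- The complex matrix `N^{-1/2} A` whose resolvent is `resolventMatrix A`. -/
noncomputable def normalized (A : Matrix (Fin N) (Fin N) ℝ) : Matrix (Fin N) (Fin N) ℂ :=
  ((1 / Real.sqrt N) • A).map fun x : ℝ => (x : ℂ)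

theorem resolventMatrix_eq_inv (A : Matrix (Fin N) (Fin N) ℝ) (z : ℂ) :
    resolventMatrix A z = (z • (1 : Matrix (Fin N) (Fin N) ℂ) - normalized A)⁻¹ := rfl

theorem normalized_sub (A B : Matrix (Fin N) (Fin N) ℝ) :
    normalized (A - B) = normalized A - normalized B := by
  ext a b
  simp [normalized, mul_sub]

theorem isSymm_normalized (hA : A.IsSymm) : (normalized A).IsSymm :=
  (hA.smul _).map _

theorem isHermitian_normalized (hA : A.IsSymm) : (normalized A).IsHermitian := by
  ext a b
  simp [normalized, hA.apply a b]

theorem isUnit_smul_one_sub_normalized (hA : A.IsSymm) (hz : z.im ≠ 0) :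
    IsUnit (z • (1 : Matrix (Fin N) (Fin N) ℂ) - normalized A) :=
  isUnit_smul_one_sub_of_isHermitian (isHermitian_normalized hA) hz

theorem isSymm_resolventMatrix (hA : A.IsSymm) (z : ℂ) : (resolventMatrix A z).IsSymm := by
  rw [resolventMatrix_eq_inv, Matrix.IsSymm, Matrix.transpose_nonsing_inv, Matrix.transpose_sub,
    Matrix.transpose_smul, Matrix.transpose_one, (isSymm_normalized hA).eq]

theorem resolventMatrix_sub (hA : A.IsSymm) (hB : B.IsSymm) (hz : z.im ≠ 0) :
    resolventMatrix A z - resolventMatrix B z =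
      resolventMatrix B z * normalized (A - B) * resolventMatrix A z := by
  have hunit := isUnit_smul_one_sub_normalized hA hz
  have hunit' := isUnit_smul_one_sub_normalized hB hz
  rw [← neg_sub, resolventMatrix_eq_inv, resolventMatrix_eq_inv,
    Matrix.inv_sub_inv (iff_of_true hunit' hunit), normalized_sub, ← Matrix.neg_mul,
    ← Matrix.mul_neg]
  congr 2
  abel

theorem opNorm_nonneg (M : Matrix (Fin N) (Fin N) ℂ) : 0 ≤ opNorm M := norm_nonneg _

theorem opNorm_resolventMatrix_le (hA : A.IsSymm) (hz : z.im ≠ 0) :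
    opNorm (resolventMatrix A z) ≤ |z.im|⁻¹ := by
  let φ := Matrix.toEuclideanCLM (n := Fin N) (𝕜 := ℂ)
  have hsa : IsSelfAdjoint (φ (normalized A)) :=
    IsSelfAdjoint.map (x := normalized A) (isHermitian_normalized hA) φ
  refine ContinuousLinearMap.opNorm_le_bound _ (by positivity) fun v => ?_
  have hinv : z • φ (resolventMatrix A z) v - φ (normalized A) (φ (resolventMatrix A z) v) = v :=
    calc _ = φ ((z • (1 : Matrix (Fin N) (Fin N) ℂ) - normalized A) * resolventMatrix A z) v := by
          simp [φ]
      _ = v := by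
          rw [resolventMatrix_eq_inv, Matrix.mul_nonsing_inv _
            ((Matrix.isUnit_iff_isUnit_det _).mp (isUnit_smul_one_sub_normalized hA hz)), map_one]
          rfl
  have hbelow := abs_im_mul_norm_le_norm_smul_sub hsa.isSymmetric z (φ (resolventMatrix A z) v)
  rw [ContinuousLinearMap.coe_coe, hinv] at hbelow
  rwa [inv_mul_eq_div, le_div_iff₀' (abs_pos.mpr hz)]

theorem sum_norm_sq_col_le_opNorm_sq (M : Matrix (Fin N) (Fin N) ℂ) (j : Fin N) :
    ∑ k, ‖M k j‖ ^ 2 ≤ opNorm M ^ 2 := by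
  let φ := Matrix.toEuclideanCLM (n := Fin N) (𝕜 := ℂ)
  calc ∑ k, ‖M k j‖ ^ 2 = ‖φ M (EuclideanSpace.single j 1)‖ ^ 2 := by
        simp [EuclideanSpace.norm_sq_eq, φ, Matrix.ofLp_toEuclideanCLM]
    _ ≤ opNorm M ^ 2 := by
        have hle := (φ M).le_opNorm (EuclideanSpace.single j 1)
        rw [PiLp.norm_single, norm_one, mul_one] at hle
        exact pow_le_pow_left₀ (norm_nonneg _) hle 2

theorem norm_apply_le_opNorm (M : Matrix (Fin N) (Fin N) ℂ) (i j : Fin N) :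
    ‖M i j‖ ≤ opNorm M :=
  le_of_sq_le_sq ((Finset.single_le_sum (f := fun k => ‖M k j‖ ^ 2) (fun _ _ => sq_nonneg _)
    (Finset.mem_univ i)).trans (sum_norm_sq_col_le_opNorm_sq M j)) (opNorm_nonneg M)

theorem sum_norm_sq_row_le_opNorm_sq {M : Matrix (Fin N) (Fin N) ℂ} (hM : M.IsSymm)
    (i : Fin N) : ∑ k, ‖M i k‖ ^ 2 ≤ opNorm M ^ 2 := by
  simp_rw [← hM.apply i]
  exact sum_norm_sq_col_le_opNorm_sq M i

theorem continuous_opNorm : Continuous (opNorm (N := N)) :=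
  (LinearMap.continuous_of_finiteDimensional
    (Matrix.toEuclideanCLM (n := Fin N) (𝕜 := ℂ)).toAlgEquiv.toLinearMap).norm

end Resolvent

section SymMatrix

/-- The positions `(j, k)`, `j ≤ k`, of the entries on and above the diagonal. -/
abbrev UpperIndex (N : ℕ) : Type := {p : Fin N × Fin N // p.1 ≤ p.2}

variable {N : ℕ}

/-- The one of the positions `(j, k)`, `(k, j)` that lies on or above the diagonal. -/
def upperIndex (j k : Fin N) : UpperIndex N := ⟨(min j k, max j k), min_le_max⟩

theorem upperIndex_comm (j k : Fin N) : upperIndex j k = upperIndex k j := by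
  simp only [upperIndex, min_comm, max_comm]

theorem upperIndex_of_le {j k : Fin N} (h : j ≤ k) : upperIndex j k = ⟨(j, k), h⟩ := by
  simp only [upperIndex, min_eq_left h, max_eq_right h]

theorem upperIndex_eq_iff {j k : Fin N} {p : UpperIndex N} :
    upperIndex j k = p ↔ p.1 = (j, k) ∨ p.1 = (k, j) := by
  obtain ⟨⟨a, b⟩, hab⟩ := p
  rcases le_total j k with h | h
  · rw [upperIndex_of_le h]
    grind
  · rw [upperIndex_comm, upperIndex_of_le h]
    grind

/-- The symmetric matrix with given entries on and above the diagonal. -/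
def symMatrix (x : UpperIndex N → ℝ) : Matrix (Fin N) (Fin N) ℝ :=
  Matrix.of fun j k => x (upperIndex j k)

theorem isSymm_symMatrix (x : UpperIndex N → ℝ) : (symMatrix x).IsSymm :=
  Matrix.IsSymm.ext fun j k => congrArg x (upperIndex_comm k j)

theorem symMatrix_of_isSymm {A : Matrix (Fin N) (Fin N) ℝ} (hA : A.IsSymm) :
    symMatrix (fun p => A p.1.1 p.1.2) = A := by
  ext j k
  rcases le_total j k with h | h
  · simp [symMatrix, upperIndex_of_le h]
  · simp [symMatrix, upperIndex_comm j k, upperIndex_of_le h, hA.apply j k]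

theorem continuous_symMatrix : Continuous (symMatrix (N := N)) :=
  continuous_matrix fun j k => continuous_apply (upperIndex j k)

theorem symMatrix_sub_update (x : UpperIndex N → ℝ) (p : UpperIndex N) :
    symMatrix x - symMatrix (Function.update x p 0) =
      if p.1.1 = p.1.2 then Matrix.single p.1.1 p.1.1 (x p)
      else Matrix.single p.1.1 p.1.2 (x p) + Matrix.single p.1.2 p.1.1 (x p) := by
  ext a b
  have hab : (symMatrix x - symMatrix (Function.update x p 0)) a b =
      if upperIndex a b = p then x p else 0 := by
    by_cases h : upperIndex a b = p <;> simp [symMatrix, Function.update_apply, h]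
  obtain ⟨⟨k, l⟩, hkl⟩ := p
  simp only [hab, upperIndex_eq_iff, Prod.mk.injEq]
  split_ifs <;> simp only [Matrix.add_apply, Matrix.single_apply] <;> grind

theorem continuous_resolventMatrix_symMatrix {z : ℂ} (hz : z.im ≠ 0) :
    Continuous fun x : UpperIndex N → ℝ => resolventMatrix (symMatrix x) z := by
  have hc : Continuous fun x : UpperIndex N → ℝ =>
      z • (1 : Matrix (Fin N) (Fin N) ℂ) - normalized (symMatrix x) :=
    continuous_const.sub
      ((continuous_symMatrix.const_smul (1 / Real.sqrt N)).matrix_map Complex.continuous_ofReal)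
  simp_rw [resolventMatrix_eq_inv, Matrix.inv_def, Ring.inverse_eq_inv']
  exact (hc.matrix_det.inv₀ fun x => ((Matrix.isUnit_iff_isUnit_det _).mp
    (isUnit_smul_one_sub_normalized (isSymm_symMatrix x) hz)).ne_zero).smul hc.matrix_adjugate

theorem norm_resolventMatrix_sub_update_le {z : ℂ} (hz : z.im ≠ 0) (x : UpperIndex N → ℝ)
    {k l : Fin N} (hkl : k ≤ l) (a b : Fin N) :
    ‖resolventMatrix (symMatrix x) z a b -
        resolventMatrix (symMatrix (Function.update x ⟨(k, l), hkl⟩ 0)) z a b‖ ≤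
      |x ⟨(k, l), hkl⟩| / Real.sqrt N *
        (‖resolventMatrix (symMatrix (Function.update x ⟨(k, l), hkl⟩ 0)) z a k‖ *
            ‖resolventMatrix (symMatrix x) z l b‖ +
          ‖resolventMatrix (symMatrix (Function.update x ⟨(k, l), hkl⟩ 0)) z a l‖ *
            ‖resolventMatrix (symMatrix x) z k b‖) := by
  set p : UpperIndex N := ⟨(k, l), hkl⟩
  set M := resolventMatrix (symMatrix x) z
  set M₀ := resolventMatrix (symMatrix (Function.update x p 0)) z
  have hsingle (i j : Fin N) : ‖(M₀ * normalized (Matrix.single i j (x p)) * M) a b‖ =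
      |x p| / Real.sqrt N * (‖M₀ a i‖ * ‖M j b‖) := by
    have : normalized (Matrix.single i j (x p)) =
        Matrix.single i j (((1 / Real.sqrt N * x p : ℝ) : ℂ)) := by
      rw [normalized, Matrix.smul_single, smul_eq_mul]
      exact Matrix.map_single i j _ Complex.ofRealHom
    rw [this, Matrix.mul_assoc, Matrix.mul_apply,
      Finset.sum_eq_single i (fun c _ hc => by simp [hc]) (by simp)]
    simp [abs_of_nonneg (Real.sqrt_nonneg _)]
    ring
  rw [← Matrix.sub_apply, resolventMatrix_sub (isSymm_symMatrix _) (isSymm_symMatrix _) hz,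
    symMatrix_sub_update]
  split_ifs with h
  · have h' : k = l := h
    rw [hsingle, ← h']
    exact mul_le_mul_of_nonneg_left (le_add_of_nonneg_left (by positivity)) (by positivity)
  · have hadd (A B : Matrix (Fin N) (Fin N) ℝ) :
        normalized (A + B) = normalized A + normalized B := by
      rw [normalized, smul_add, Matrix.map_add _ Complex.ofReal_add, normalized, normalized]
    rw [hadd, Matrix.mul_add, Matrix.add_mul, Matrix.add_apply, mul_add]
    exact (norm_add_le _ _).trans_eq (by rw [hsingle, hsingle])

end SymMatrix

section EfronStein

variable {E : Type*} [NormedAddCommGroup E]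

theorem memLp_sub_of_bound {Ω : Type*} [MeasurableSpace Ω] {P : Measure Ω} [IsFiniteMeasure P]
    {F H : Ω → E} {K : ℝ} (hF : StronglyMeasurable F) (hH : StronglyMeasurable H)
    (hFK : ∀ ω, ‖F ω‖ ≤ K) (hHK : ∀ ω, ‖H ω‖ ≤ K) : MemLp (fun ω => F ω - H ω) 2 P :=
  (MemLp.of_bound hF.aestronglyMeasurable K (ae_of_all _ hFK)).sub
    (MemLp.of_bound hH.aestronglyMeasurable K (ae_of_all _ hHK))

theorem integrable_norm_sub_sq {Ω : Type*} [MeasurableSpace Ω] {P : Measure Ω}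
    [IsFiniteMeasure P] {F H : Ω → E} {K : ℝ} (hF : StronglyMeasurable F)
    (hH : StronglyMeasurable H) (hFK : ∀ ω, ‖F ω‖ ≤ K) (hHK : ∀ ω, ‖H ω‖ ≤ K) :
    Integrable (fun ω => ‖F ω - H ω‖ ^ 2) P :=
  (memLp_sub_of_bound hF hH hFK hHK).integrable_norm_pow two_ne_zero

variable [InnerProductSpace ℝ E] [CompleteSpace E]

theorem integral_norm_sub_sq_eq {Ω : Type*} [MeasurableSpace Ω] {P : Measure Ω}
    [IsProbabilityMeasure P] {F : Ω → E} (hF : MemLp F 2 P) (c : E) :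
    ∫ ω, ‖F ω - c‖ ^ 2 ∂P = ∫ ω, ‖F ω - ∫ ω', F ω' ∂P‖ ^ 2 ∂P + ‖∫ ω', F ω' ∂P - c‖ ^ 2 := by
  set m := ∫ ω', F ω' ∂P with hm
  have hFm : MemLp (fun ω => F ω - m) 2 P := hF.sub (memLp_const m)
  have hFi : Integrable F P := hF.integrable one_le_two
  have hFmi : Integrable (fun ω => F ω - m) P := hFm.integrable one_le_two
  have hcross : ∫ ω, inner ℝ (m - c) (F ω - m) ∂P = 0 := by
    rw [integral_inner hFmi, integral_sub hFi (integrable_const m)]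
    simp [← hm]
  have hexpand (ω : Ω) : ‖F ω - c‖ ^ 2 =
      ‖F ω - m‖ ^ 2 + 2 * inner ℝ (m - c) (F ω - m) + ‖m - c‖ ^ 2 := by
    rw [← sub_add_sub_cancel (F ω) m c, norm_add_sq_real, real_inner_comm]
  have hsq : Integrable (fun ω => ‖F ω - m‖ ^ 2) P := hFm.integrable_norm_pow two_ne_zero
  have hlin : Integrable (fun ω => 2 * inner ℝ (m - c) (F ω - m)) P :=
    (hFmi.const_inner (m - c)).const_mul 2
  have hsum : Integrable (fun ω => ‖F ω - m‖ ^ 2 + 2 * inner ℝ (m - c) (F ω - m)) P :=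
    hsq.add hlin
  simp_rw [hexpand]
  rw [integral_add hsum (integrable_const _), integral_add hsq hlin,
    integral_const_mul, hcross]
  simp

theorem integral_norm_sub_integral_sq_le {Ω : Type*} [MeasurableSpace Ω] {P : Measure Ω}
    [IsProbabilityMeasure P] {F : Ω → E} (hF : MemLp F 2 P) (c : E) :
    ∫ ω, ‖F ω - ∫ ω', F ω' ∂P‖ ^ 2 ∂P ≤ ∫ ω, ‖F ω - c‖ ^ 2 ∂P := by
  rw [integral_norm_sub_sq_eq hF c]
  exact le_add_of_nonneg_right (sq_nonneg _)

theorem norm_integral_sq_le_integral_norm_sq {Ω : Type*} [MeasurableSpace Ω] {P : Measure Ω}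
    [IsProbabilityMeasure P] {F : Ω → E} (hF : MemLp F 2 P) :
    ‖∫ ω, F ω ∂P‖ ^ 2 ≤ ∫ ω, ‖F ω‖ ^ 2 ∂P := by
  have h := integral_norm_sub_sq_eq hF 0
  simp only [sub_zero] at h
  rw [h]
  exact le_add_of_nonneg_left (integral_nonneg fun _ => sq_nonneg _)

theorem variance_prod_le {α β : Type*} [MeasurableSpace α] [MeasurableSpace β]
    {μ : Measure α} {ν : Measure β} [IsProbabilityMeasure μ] [IsProbabilityMeasure ν]
    {F : α × β → E} {K : ℝ} (hF : StronglyMeasurable F) (hK : ∀ x, ‖F x‖ ≤ K) (a₀ : α) :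
    ∫ x, ‖F x - ∫ y, F y ∂μ.prod ν‖ ^ 2 ∂μ.prod ν ≤
      ∫ x, ‖F x - F (a₀, x.2)‖ ^ 2 ∂μ.prod ν +
        ∫ a, ∫ b, ‖F (a, b) - ∫ b', F (a, b') ∂ν‖ ^ 2 ∂ν ∂μ := by
  set g : α → E := fun a => ∫ b, F (a, b) ∂ν
  have hslice (a : α) : StronglyMeasurable fun b => F (a, b) :=
    hF.comp_measurable measurable_prodMk_left
  have hslice_memLp (a : α) : MemLp (fun b => F (a, b)) 2 ν :=
    .of_bound (hslice a).aestronglyMeasurable K (ae_of_all _ fun b => hK (a, b))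
  have hg : StronglyMeasurable g := hF.integral_prod_right'
  have hgK (a : α) : ‖g a‖ ≤ K := by
    simpa using norm_integral_le_of_norm_le_const (μ := ν) (ae_of_all _ fun b => hK (a, b))
  have hmean : ∫ y, F y ∂μ.prod ν = ∫ a, g a ∂μ :=
    integral_prod _ (.of_bound hF.aestronglyMeasurable K (ae_of_all _ hK))
  rw [hmean]
  set m := ∫ a, g a ∂μ
  have hmK : ‖m‖ ≤ K := by
    simpa using norm_integral_le_of_norm_le_const (μ := μ) (ae_of_all _ hgK)
  have hfreeze : Integrable (fun x : α × β => ‖F x - F (a₀, x.2)‖ ^ 2) (μ.prod ν) :=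
    integrable_norm_sub_sq hF ((hslice a₀).comp_measurable measurable_snd) hK fun x => hK _
  have hbetween : ∫ a, ‖g a - m‖ ^ 2 ∂μ ≤ ∫ x, ‖F x - F (a₀, x.2)‖ ^ 2 ∂μ.prod ν :=
    calc ∫ a, ‖g a - m‖ ^ 2 ∂μ ≤ ∫ a, ‖g a - g a₀‖ ^ 2 ∂μ :=
          integral_norm_sub_integral_sq_le
            (.of_bound hg.aestronglyMeasurable K (ae_of_all _ hgK)) _
      _ ≤ ∫ a, ∫ b, ‖F (a, b) - F (a₀, b)‖ ^ 2 ∂ν ∂μ := by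
          refine integral_mono (integrable_norm_sub_sq hg stronglyMeasurable_const hgK
            fun _ => hgK a₀) hfreeze.integral_prod_left fun a => ?_
          have hsub : g a - g a₀ = ∫ b, (F (a, b) - F (a₀, b)) ∂ν :=
            (integral_sub ((hslice_memLp a).integrable one_le_two)
              ((hslice_memLp a₀).integrable one_le_two)).symm
          simp only [hsub]
          exact norm_integral_sq_le_integral_norm_sq ((hslice_memLp a).sub (hslice_memLp a₀))
      _ = _ := (integral_prod _ hfreeze).symm
  calc ∫ x, ‖F x - m‖ ^ 2 ∂μ.prod ν
      = ∫ a, (‖g a - m‖ ^ 2 + ∫ b, ‖F (a, b) - g a‖ ^ 2 ∂ν) ∂μ := by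
        rw [integral_prod _ (integrable_norm_sub_sq hF stronglyMeasurable_const hK fun _ => hmK)]
        refine integral_congr_ae (ae_of_all _ fun a => ?_)
        exact (integral_norm_sub_sq_eq (hslice_memLp a) m).trans (add_comm _ _)
    _ = ∫ a, ‖g a - m‖ ^ 2 ∂μ + ∫ a, ∫ b, ‖F (a, b) - g a‖ ^ 2 ∂ν ∂μ :=
        integral_add (integrable_norm_sub_sq hg stronglyMeasurable_const hgK fun _ => hmK)
          (integrable_norm_sub_sq hF (hg.comp_measurable measurable_fst) hK
            fun x => hgK x.1).integral_prod_left
    _ ≤ _ := by gcongr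

theorem integral_pi_fin_succ {α G : Type*} [MeasurableSpace α] [NormedAddCommGroup G]
    [NormedSpace ℝ G] {n : ℕ} (μ : Fin (n + 1) → Measure α) [∀ i, SigmaFinite (μ i)]
    (f : (Fin (n + 1) → α) → G) :
    ∫ x, f x ∂Measure.pi μ =
      ∫ y : α × (Fin n → α), f (Fin.cons y.1 y.2)
        ∂(μ 0).prod (Measure.pi fun i => μ i.succ) := by
  have h := (measurePreserving_piFinSuccAbove μ 0).symm.integral_comp' f
  rw [← h]
  simp [MeasurableEquiv.piFinSuccAbove, Fin.insertNthEquiv]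

theorem measurable_update_const {ι α : Type*} [DecidableEq ι] [MeasurableSpace α] (i : ι) (c : α) :
    Measurable fun x : ι → α => Function.update x i c :=
  measurable_pi_iff.mpr fun j => by
    rcases eq_or_ne j i with rfl | h
    · simp
    · simpa [Function.update_of_ne h] using measurable_pi_apply j

theorem efronStein_fin {α : Type*} [MeasurableSpace α] (c : α) {n : ℕ} (μ : Fin n → Measure α)
    [∀ i, IsProbabilityMeasure (μ i)] {F : (Fin n → α) → E} {K : ℝ} (hF : StronglyMeasurable F)
    (hK : ∀ x, ‖F x‖ ≤ K) :
    ∫ x, ‖F x - ∫ y, F y ∂Measure.pi μ‖ ^ 2 ∂Measure.pi μ ≤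
      ∑ i, ∫ x, ‖F x - F (Function.update x i c)‖ ^ 2 ∂Measure.pi μ := by
  induction n with
  | zero => simp [Subsingleton.elim _ (![] : Fin 0 → α)]
  | succ n ih =>
    have hcons : Measurable fun y : α × (Fin n → α) => (Fin.cons y.1 y.2 : Fin (n + 1) → α) :=
      measurable_pi_iff.mpr (Fin.cases measurable_fst
        fun i => (measurable_pi_apply i).comp measurable_snd)
    have hF' := hF.comp_measurable hcons
    simp_rw [Fin.sum_univ_succ, integral_pi_fin_succ, Fin.update_cons_zero, ← Fin.cons_update]
    refine (variance_prod_le hF' (fun _ => hK _) c).trans (add_le_add_right ?_ _)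
    set ν := Measure.pi fun i : Fin n => μ i.succ
    have hint (i : Fin n) : Integrable (fun y : α × (Fin n → α) =>
        ‖F (Fin.cons y.1 y.2) - F (Fin.cons y.1 (Function.update y.2 i c))‖ ^ 2)
        ((μ 0).prod ν) :=
      integrable_norm_sub_sq hF' (hF'.comp_measurable
        (measurable_fst.prodMk ((measurable_update_const i c).comp measurable_snd)))
        (fun _ => hK _) fun _ => hK _
    calc _ ≤ ∫ a, ∑ i, ∫ b, ‖F (Fin.cons a b) - F (Fin.cons a (Function.update b i c))‖ ^ 2
            ∂ν ∂μ 0 :=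
          integral_mono_of_nonneg
            (ae_of_all _ fun a => integral_nonneg fun _ => sq_nonneg _)
            (integrable_finsetSum _ fun i _ => (hint i).integral_prod_left)
            (ae_of_all _ fun a => ih _ (hF'.comp_measurable measurable_prodMk_left)
              fun b => hK _)
      _ = _ := by
          rw [integral_finsetSum _ fun i _ => (hint i).integral_prod_left]
          exact Finset.sum_congr rfl fun i _ => (integral_prod _ (hint i)).symm

theorem efronStein {ι α : Type*} [Fintype ι] [DecidableEq ι] [MeasurableSpace α]
    (c : α) (μ : ι → Measure α) [∀ i, IsProbabilityMeasure (μ i)] {F : (ι → α) → E} {K : ℝ}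
    (hF : StronglyMeasurable F) (hK : ∀ x, ‖F x‖ ≤ K) :
    ∫ x, ‖F x - ∫ y, F y ∂Measure.pi μ‖ ^ 2 ∂Measure.pi μ ≤
      ∑ i, ∫ x, ‖F x - F (Function.update x i c)‖ ^ 2 ∂Measure.pi μ := by
  set e := (Fintype.equivFin ι).symm
  set T := MeasurableEquiv.piCongrLeft (fun _ : ι => α) e
  have hT : MeasurePreserving T (Measure.pi fun k => μ (e k)) (Measure.pi μ) :=
    measurePreserving_piCongrLeft μ e
  have hT_apply (x : Fin (Fintype.card ι) → α) : T x = x ∘ e.symm := by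
    ext i
    simpa using MeasurableEquiv.piCongrLeft_apply_apply (β := fun _ : ι => α) e x (e.symm i)
  have hupdate (x : Fin (Fintype.card ι) → α) (k : Fin (Fintype.card ι)) :
      Function.update (T x) (e k) c = T (Function.update x k c) := by
    rw [hT_apply, hT_apply, Function.update_comp_equiv, Equiv.symm_symm]
  have h := efronStein_fin c (fun k => μ (e k)) (hF.comp_measurable T.measurable) fun x => hK _
  have hinfluence (k : Fin (Fintype.card ι)) :=
    hT.integral_comp' fun x => ‖F x - F (Function.update x (e k) c)‖ ^ 2
  simp only [Function.comp_apply, ← hupdate, hinfluence] at h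
  rwa [hT.integral_comp' F, hT.integral_comp' fun x => ‖F x - ∫ y, F y ∂Measure.pi μ‖ ^ 2,
    e.sum_comp fun i => ∫ x, ‖F x - F (Function.update x i c)‖ ^ 2 ∂Measure.pi μ] at h

end EfronStein

section Perturbation

variable {N : ℕ}

/-- The weight `|M i k|² + |M i l|²`. For `M` the resolvent it controls the influence on row `i`
of the matrix entries at `(k, l)` and `(l, k)`. -/
noncomputable def rowWeight (M : Matrix (Fin N) (Fin N) ℂ) (i k l : Fin N) : ℝ :=
  ‖M i k‖ ^ 2 + ‖M i l‖ ^ 2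

/-- The weight `|M i k|² |M l j|² + |M i l|² |M k j|²`. For `M` the resolvent it is, up to a
constant, the squared first derivative of `M i j` in the matrix entry at `(k, l)`. -/
noncomputable def pairWeight (M : Matrix (Fin N) (Fin N) ℂ) (i j k l : Fin N) : ℝ :=
  ‖M i k‖ ^ 2 * ‖M l j‖ ^ 2 + ‖M i l‖ ^ 2 * ‖M k j‖ ^ 2

theorem rowWeight_nonneg (M : Matrix (Fin N) (Fin N) ℂ) (i k l : Fin N) :
    0 ≤ rowWeight M i k l := by
  unfold rowWeight; positivity

theorem pairWeight_nonneg (M : Matrix (Fin N) (Fin N) ℂ) (i j k l : Fin N) :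
    0 ≤ pairWeight M i j k l := by
  unfold pairWeight; positivity

theorem norm_sq_le_two_mul_add {E : Type*} [SeminormedAddCommGroup E] (a b : E) :
    ‖a‖ ^ 2 ≤ 2 * ‖b‖ ^ 2 + 2 * ‖a - b‖ ^ 2 := by
  have h := pow_le_pow_left₀ (norm_nonneg a) (norm_le_norm_add_norm_sub' a b) 2
  linarith [add_sq_le (a := ‖b‖) (b := ‖a - b‖)]

variable {M M₀ : Matrix (Fin N) (Fin N) ℂ} {t h : ℝ} {k l : Fin N}

theorem norm_sq_le_of_norm_le (hM : ∀ a b, ‖M a b‖ ≤ t) (a b : Fin N) : ‖M a b‖ ^ 2 ≤ t ^ 2 :=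
  pow_le_pow_left₀ (norm_nonneg _) (hM a b) 2

theorem rowWeight_le (hM : ∀ a b, ‖M a b‖ ≤ t) (i k l : Fin N) :
    rowWeight M i k l ≤ 2 * t ^ 2 := by
  have hk := norm_sq_le_of_norm_le hM i k
  have hl := norm_sq_le_of_norm_le hM i l
  unfold rowWeight
  linarith

theorem pairWeight_le (hM : ∀ a b, ‖M a b‖ ≤ t) (i j k l : Fin N) :
    pairWeight M i j k l ≤ rowWeight M i k l * t ^ 2 := by
  rw [rowWeight, add_mul]
  exact add_le_add
    (mul_le_mul_of_nonneg_left (norm_sq_le_of_norm_le hM l j) (sq_nonneg _))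
    (mul_le_mul_of_nonneg_left (norm_sq_le_of_norm_le hM k j) (sq_nonneg _))

theorem norm_sub_sq_le
    (hsub : ∀ a b, ‖M a b - M₀ a b‖ ≤ h * (‖M₀ a k‖ * ‖M l b‖ + ‖M₀ a l‖ * ‖M k b‖))
    (a b : Fin N) :
    ‖M a b - M₀ a b‖ ^ 2 ≤
      2 * h ^ 2 * (‖M₀ a k‖ ^ 2 * ‖M l b‖ ^ 2 + ‖M₀ a l‖ ^ 2 * ‖M k b‖ ^ 2) :=
  calc ‖M a b - M₀ a b‖ ^ 2 ≤ (h * (‖M₀ a k‖ * ‖M l b‖ + ‖M₀ a l‖ * ‖M k b‖)) ^ 2 :=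
        pow_le_pow_left₀ (norm_nonneg _) (hsub a b) 2
    _ ≤ h ^ 2 * (2 * ((‖M₀ a k‖ * ‖M l b‖) ^ 2 + (‖M₀ a l‖ * ‖M k b‖) ^ 2)) := by
        rw [mul_pow]
        exact mul_le_mul_of_nonneg_left add_sq_le (sq_nonneg h)
    _ = _ := by ring

theorem norm_sub_sq_le_rowWeight (hM : ∀ a b, ‖M a b‖ ≤ t)
    (hsub : ∀ a b, ‖M a b - M₀ a b‖ ≤ h * (‖M₀ a k‖ * ‖M l b‖ + ‖M₀ a l‖ * ‖M k b‖))
    (a b : Fin N) :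
    ‖M a b - M₀ a b‖ ^ 2 ≤ 2 * h ^ 2 * t ^ 2 * rowWeight M₀ a k l :=
  calc ‖M a b - M₀ a b‖ ^ 2
      ≤ 2 * h ^ 2 * (‖M₀ a k‖ ^ 2 * ‖M l b‖ ^ 2 + ‖M₀ a l‖ ^ 2 * ‖M k b‖ ^ 2) :=
        norm_sub_sq_le hsub a b
    _ ≤ 2 * h ^ 2 * (‖M₀ a k‖ ^ 2 * t ^ 2 + ‖M₀ a l‖ ^ 2 * t ^ 2) := by
        gcongr <;> exact hM _ _
    _ = 2 * h ^ 2 * t ^ 2 * rowWeight M₀ a k l := by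
        rw [rowWeight]
        ring

theorem rowWeight_le_of_norm_sub_le (hM : ∀ a b, ‖M a b‖ ≤ t)
    (hsub : ∀ a b, ‖M a b - M₀ a b‖ ≤ h * (‖M₀ a k‖ * ‖M l b‖ + ‖M₀ a l‖ * ‖M k b‖))
    (i : Fin N) :
    rowWeight M₀ i k l ≤ 2 * rowWeight M i k l + 8 * h ^ 2 * t ^ 2 * rowWeight M₀ i k l := by
  have hentry (b : Fin N) :
      ‖M₀ i b‖ ^ 2 ≤ 2 * ‖M i b‖ ^ 2 + 4 * h ^ 2 * t ^ 2 * rowWeight M₀ i k l := by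
    have hexpand := norm_sq_le_two_mul_add (M₀ i b) (M i b)
    rw [norm_sub_rev] at hexpand
    linarith [norm_sub_sq_le_rowWeight hM hsub i b]
  calc rowWeight M₀ i k l = ‖M₀ i k‖ ^ 2 + ‖M₀ i l‖ ^ 2 := rfl
    _ ≤ 2 * (‖M i k‖ ^ 2 + ‖M i l‖ ^ 2) + 8 * h ^ 2 * t ^ 2 * rowWeight M₀ i k l := by
        linarith [hentry k, hentry l]

theorem norm_sub_sq_le_of_norm_le (hM : ∀ a b, ‖M a b‖ ≤ t) (hM₀ : ∀ a b, ‖M₀ a b‖ ≤ t)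
    (hsub : ∀ a b, ‖M a b - M₀ a b‖ ≤ h * (‖M₀ a k‖ * ‖M l b‖ + ‖M₀ a l‖ * ‖M k b‖))
    (a b : Fin N) : ‖M a b - M₀ a b‖ ^ 2 ≤ 4 * h ^ 2 * t ^ 4 :=
  calc ‖M a b - M₀ a b‖ ^ 2 ≤ 2 * h ^ 2 * t ^ 2 * rowWeight M₀ a k l :=
        norm_sub_sq_le_rowWeight hM hsub a b
    _ ≤ 2 * h ^ 2 * t ^ 2 * (2 * t ^ 2) :=
        mul_le_mul_of_nonneg_left (rowWeight_le hM₀ a k l) (by positivity)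
    _ = 4 * h ^ 2 * t ^ 4 := by ring

theorem norm_sub_sq_le_pairWeight (hM : ∀ a b, ‖M a b‖ ≤ t) (hM₀ : ∀ a b, ‖M₀ a b‖ ≤ t)
    (hsub : ∀ a b, ‖M a b - M₀ a b‖ ≤ h * (‖M₀ a k‖ * ‖M l b‖ + ‖M₀ a l‖ * ‖M k b‖))
    (i j : Fin N) :
    ‖M i j - M₀ i j‖ ^ 2 ≤
      4 * h ^ 2 * pairWeight M₀ i j k l + 16 * h ^ 4 * t ^ 4 * rowWeight M₀ i k l := by
  have hcol (c : Fin N) : ‖M c j‖ ^ 2 ≤ 2 * ‖M₀ c j‖ ^ 2 + 8 * h ^ 2 * t ^ 4 := by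
    linarith [norm_sq_le_two_mul_add (M c j) (M₀ c j), norm_sub_sq_le_of_norm_le hM hM₀ hsub c j]
  calc ‖M i j - M₀ i j‖ ^ 2
      ≤ 2 * h ^ 2 * (‖M₀ i k‖ ^ 2 * ‖M l j‖ ^ 2 + ‖M₀ i l‖ ^ 2 * ‖M k j‖ ^ 2) :=
        norm_sub_sq_le hsub i j
    _ ≤ 2 * h ^ 2 * (‖M₀ i k‖ ^ 2 * (2 * ‖M₀ l j‖ ^ 2 + 8 * h ^ 2 * t ^ 4) +
          ‖M₀ i l‖ ^ 2 * (2 * ‖M₀ k j‖ ^ 2 + 8 * h ^ 2 * t ^ 4)) := by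
        gcongr <;> exact hcol _
    _ = _ := by
        rw [pairWeight, rowWeight]
        ring

theorem pairWeight_le_of_norm_sub_le (hM : ∀ a b, ‖M a b‖ ≤ t) (hM₀ : ∀ a b, ‖M₀ a b‖ ≤ t)
    (hsub : ∀ a b, ‖M a b - M₀ a b‖ ≤ h * (‖M₀ a k‖ * ‖M l b‖ + ‖M₀ a l‖ * ‖M k b‖))
    (i j : Fin N) :
    pairWeight M₀ i j k l ≤
      4 * pairWeight M i j k l + 24 * h ^ 2 * t ^ 4 * rowWeight M₀ i k l := by
  have hcol (c : Fin N) : ‖M₀ c j‖ ^ 2 ≤ 2 * ‖M c j‖ ^ 2 + 8 * h ^ 2 * t ^ 4 := by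
    have hexpand := norm_sq_le_two_mul_add (M₀ c j) (M c j)
    rw [norm_sub_rev] at hexpand
    linarith [norm_sub_sq_le_of_norm_le hM hM₀ hsub c j]
  have hrow (b c : Fin N) : ‖M₀ i b‖ ^ 2 * ‖M c j‖ ^ 2 ≤
      2 * (‖M i b‖ ^ 2 * ‖M c j‖ ^ 2) + 4 * h ^ 2 * t ^ 4 * rowWeight M₀ i k l :=
    calc ‖M₀ i b‖ ^ 2 * ‖M c j‖ ^ 2
        ≤ (2 * ‖M i b‖ ^ 2 + 2 * ‖M₀ i b - M i b‖ ^ 2) * ‖M c j‖ ^ 2 :=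
          mul_le_mul_of_nonneg_right (norm_sq_le_two_mul_add _ _) (sq_nonneg _)
      _ = 2 * (‖M i b‖ ^ 2 * ‖M c j‖ ^ 2) + 2 * (‖M i b - M₀ i b‖ ^ 2 * ‖M c j‖ ^ 2) := by
          rw [norm_sub_rev]
          ring
      _ ≤ 2 * (‖M i b‖ ^ 2 * ‖M c j‖ ^ 2) +
          2 * ((2 * h ^ 2 * t ^ 2 * rowWeight M₀ i k l) * t ^ 2) := by
          have := rowWeight_nonneg M₀ i k l
          gcongr
          · exact norm_sub_sq_le_rowWeight hM hsub i b
          · exact hM c j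
      _ = _ := by ring
  calc pairWeight M₀ i j k l
      ≤ ‖M₀ i k‖ ^ 2 * (2 * ‖M l j‖ ^ 2 + 8 * h ^ 2 * t ^ 4) +
        ‖M₀ i l‖ ^ 2 * (2 * ‖M k j‖ ^ 2 + 8 * h ^ 2 * t ^ 4) := by
        unfold pairWeight
        gcongr <;> exact hcol _
    _ = 2 * (‖M₀ i k‖ ^ 2 * ‖M l j‖ ^ 2 + ‖M₀ i l‖ ^ 2 * ‖M k j‖ ^ 2) +
        8 * h ^ 2 * t ^ 4 * rowWeight M₀ i k l := by
        rw [rowWeight]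
        ring
    _ ≤ 4 * pairWeight M i j k l + 24 * h ^ 2 * t ^ 4 * rowWeight M₀ i k l := by
        rw [pairWeight]
        linarith [hrow k l, hrow l k]

theorem sum_rowWeight_diag (M : Matrix (Fin N) (Fin N) ℂ) (i : Fin N) :
    ∑ k, rowWeight M i k k = 2 * ∑ k, ‖M i k‖ ^ 2 := by
  simp only [rowWeight, ← two_mul, Finset.mul_sum]

theorem sum_rowWeight (M : Matrix (Fin N) (Fin N) ℂ) (i : Fin N) :
    ∑ k, ∑ l, rowWeight M i k l = 2 * N * ∑ k, ‖M i k‖ ^ 2 := by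
  simp only [rowWeight, Finset.sum_add_distrib, Finset.sum_const, Finset.card_univ,
    Fintype.card_fin, nsmul_eq_mul, ← Finset.mul_sum]
  ring

theorem sum_pairWeight (M : Matrix (Fin N) (Fin N) ℂ) (i j : Fin N) :
    ∑ k, ∑ l, pairWeight M i j k l = 2 * (∑ k, ‖M i k‖ ^ 2) * ∑ l, ‖M l j‖ ^ 2 := by
  simp only [pairWeight, Finset.sum_add_distrib, ← Finset.mul_sum, ← Finset.sum_mul]
  ring

end Perturbation

section Decoupling

variable {ι α : Type*} [Fintype ι] [DecidableEq ι] [MeasurableSpace α]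
  {μ : ι → Measure α} [∀ i, IsProbabilityMeasure (μ i)]

theorem indepFun_eval_update (i : ι) (c : α) :
    IndepFun (fun x : ι → α => x i) (fun x => Function.update x i c) (Measure.pi μ) := by
  have hpi : iIndepFun (fun j (x : ι → α) => x j) (Measure.pi μ) :=
    iIndepFun_pi (X := fun _ => id) fun _ => aemeasurable_id
  have h := hpi.indepFun_finset {i} {i}ᶜ disjoint_compl_right fun j => measurable_pi_apply j
  let extend : (({i}ᶜ : Finset ι) → α) → ι → α := fun y j =>
    if hj : j ∈ ({i}ᶜ : Finset ι) then y ⟨j, hj⟩ else c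
  have hextend : Measurable extend := measurable_pi_lambda _ fun j => by
    unfold extend
    split_ifs
    · exact measurable_pi_apply _
    · exact measurable_const
  have hupdate : (fun x : ι → α => Function.update x i c) =
      extend ∘ fun x (j : ({i}ᶜ : Finset ι)) => x j := by
    funext x j
    rcases eq_or_ne j i with rfl | hj
    · simp [extend]
    · simp [extend, hj]
  rw [hupdate]
  exact h.comp (φ := fun y : ({i} : Finset ι) → α => y ⟨i, Finset.mem_singleton_self i⟩)
    (measurable_pi_apply _) hextend

theorem integral_mul_update_eq (i : ι) (c : α) {ψ : α → ℝ} {Φ : (ι → α) → ℝ}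
    (hψ : Measurable ψ) (hΦ : Measurable Φ) :
    ∫ x, ψ (x i) * Φ (Function.update x i c) ∂Measure.pi μ =
      (∫ y, ψ y ∂μ i) * ∫ x, Φ (Function.update x i c) ∂Measure.pi μ := by
  have hindep := (indepFun_eval_update (μ := μ) i c).comp hψ hΦ
  have h := hindep.integral_fun_mul_eq_mul_integral
    (hψ.comp (measurable_pi_apply i)).aestronglyMeasurable
    (hΦ.comp (measurable_update_const i c)).aestronglyMeasurable
  rw [← (measurePreserving_eval μ i).map_eq,
    integral_map (measurable_pi_apply i).aemeasurable hψ.aestronglyMeasurable]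
  exact h

theorem integrable_mul_update (i : ι) (c : α) {ψ : α → ℝ} {Φ : (ι → α) → ℝ} {K : ℝ}
    (hψ : Integrable ψ (μ i)) (hΦ : Measurable Φ) (hK : ∀ x, ‖Φ x‖ ≤ K) :
    Integrable (fun x => ψ (x i) * Φ (Function.update x i c)) (Measure.pi μ) :=
  ((measurePreserving_eval μ i).integrable_comp_of_integrable hψ).mul_bdd
    (hΦ.comp (measurable_update_const i c)).aestronglyMeasurable (ae_of_all _ fun _ => hK _)

end Decoupling

section Influence

variable {N : ℕ} {z : ℂ}

/-- The resolvent as a function of the entries of the symmetric matrix on and above the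
diagonal. -/
noncomputable def symResolvent (z : ℂ) (x : UpperIndex N → ℝ) : Matrix (Fin N) (Fin N) ℂ :=
  resolventMatrix (symMatrix x) z

theorem isSymm_symResolvent (x : UpperIndex N → ℝ) : (symResolvent z x).IsSymm :=
  isSymm_resolventMatrix (isSymm_symMatrix x) z

theorem opNorm_symResolvent_le (hz : z.im ≠ 0) (x : UpperIndex N → ℝ) :
    opNorm (symResolvent z x) ≤ |z.im|⁻¹ :=
  opNorm_resolventMatrix_le (isSymm_symMatrix x) hz

theorem norm_symResolvent_apply_le (hz : z.im ≠ 0) (x : UpperIndex N → ℝ) (a b : Fin N) :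
    ‖symResolvent z x a b‖ ≤ |z.im|⁻¹ :=
  (norm_apply_le_opNorm _ a b).trans (opNorm_symResolvent_le hz x)

theorem measurable_symResolvent_apply (hz : z.im ≠ 0) (a b : Fin N) :
    Measurable fun x : UpperIndex N → ℝ => symResolvent z x a b :=
  ((continuous_resolventMatrix_symMatrix hz).matrix_elem a b).measurable

theorem measurable_rowWeight (hz : z.im ≠ 0) (i k l : Fin N) :
    Measurable fun x => rowWeight (symResolvent z x) i k l :=
  ((measurable_symResolvent_apply hz i k).norm.pow_const 2).add
    ((measurable_symResolvent_apply hz i l).norm.pow_const 2)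

theorem measurable_pairWeight (hz : z.im ≠ 0) (i j k l : Fin N) :
    Measurable fun x => pairWeight (symResolvent z x) i j k l :=
  (((measurable_symResolvent_apply hz i k).norm.pow_const 2).mul
    ((measurable_symResolvent_apply hz l j).norm.pow_const 2)).add
  (((measurable_symResolvent_apply hz i l).norm.pow_const 2).mul
    ((measurable_symResolvent_apply hz k j).norm.pow_const 2))

theorem norm_rowWeight_symResolvent_le (hz : z.im ≠ 0) (i k l : Fin N) (x : UpperIndex N → ℝ) :
    ‖rowWeight (symResolvent z x) i k l‖ ≤ 2 * |z.im|⁻¹ ^ 2 :=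
  (Real.norm_of_nonneg (rowWeight_nonneg _ i k l)).trans_le
    (rowWeight_le (norm_symResolvent_apply_le hz x) i k l)

theorem norm_pairWeight_symResolvent_le (hz : z.im ≠ 0) (i j k l : Fin N)
    (x : UpperIndex N → ℝ) :
    ‖pairWeight (symResolvent z x) i j k l‖ ≤ 2 * |z.im|⁻¹ ^ 2 * |z.im|⁻¹ ^ 2 :=
  (Real.norm_of_nonneg (pairWeight_nonneg _ i j k l)).trans_le
    ((pairWeight_le (norm_symResolvent_apply_le hz x) i j k l).trans
      (mul_le_mul_of_nonneg_right (rowWeight_le (norm_symResolvent_apply_le hz x) i k l)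
        (sq_nonneg _)))

theorem integrable_rowWeight {P : Measure (UpperIndex N → ℝ)} [IsFiniteMeasure P]
    (hz : z.im ≠ 0) (i k l : Fin N) :
    Integrable (fun x => rowWeight (symResolvent z x) i k l) P :=
  .of_bound (measurable_rowWeight hz i k l).aestronglyMeasurable _
    (ae_of_all _ (norm_rowWeight_symResolvent_le hz i k l))

theorem integrable_pairWeight {P : Measure (UpperIndex N → ℝ)} [IsFiniteMeasure P]
    (hz : z.im ≠ 0) (i j k l : Fin N) :
    Integrable (fun x => pairWeight (symResolvent z x) i j k l) P :=
  .of_bound (measurable_pairWeight hz i j k l).aestronglyMeasurable _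
    (ae_of_all _ (norm_pairWeight_symResolvent_le hz i j k l))

theorem abs_div_sqrt_sq (y : ℝ) (N : ℕ) : (|y| / Real.sqrt N) ^ 2 = y ^ 2 / N := by
  rw [div_pow, sq_abs, Real.sq_sqrt (Nat.cast_nonneg N)]

theorem integral_le_of_le_linear_combination {Ω : Type*} [MeasurableSpace Ω] {P : Measure Ω}
    {f g₁ g₂ : Ω → ℝ} {a b : ℝ} (hf : ∀ ω, 0 ≤ f ω) (hg₁ : Integrable g₁ P)
    (hg₂ : Integrable g₂ P) (h : ∀ ω, f ω ≤ a * g₁ ω + b * g₂ ω) :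
    ∫ ω, f ω ∂P ≤ a * ∫ ω, g₁ ω ∂P + b * ∫ ω, g₂ ω ∂P := by
  rw [← integral_const_mul, ← integral_const_mul,
    ← integral_add (hg₁.const_mul a) (hg₂.const_mul b)]
  exact integral_mono_of_nonneg (ae_of_all _ hf) ((hg₁.const_mul a).add (hg₂.const_mul b))
    (ae_of_all _ h)

variable {μ : UpperIndex N → Measure ℝ} [∀ p, IsProbabilityMeasure (μ p)] {s κ : ℝ}
  {k l : Fin N} {hkl : k ≤ l}

theorem integral_pow_mul_update_le {p : UpperIndex N} {n : ℕ} (hs : ∫ y, y ^ n ∂μ p ≤ s)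
    {Φ : (UpperIndex N → ℝ) → ℝ} (hΦ : Measurable Φ) (hΦ₀ : ∀ x, 0 ≤ Φ x) :
    ∫ x, x p ^ n * Φ (Function.update x p 0) ∂Measure.pi μ ≤
      s * ∫ x, Φ (Function.update x p 0) ∂Measure.pi μ := by
  rw [integral_mul_update_eq (ψ := fun y => y ^ n) p 0 (by fun_prop) hΦ]
  exact mul_le_mul_of_nonneg_right hs (integral_nonneg fun _ => hΦ₀ _)

theorem integral_rowWeight_update_le (hz : z.im ≠ 0) (hN : 16 * s * |z.im|⁻¹ ^ 2 ≤ N)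
    (h₂ : Integrable (fun y => y ^ 2) (μ ⟨(k, l), hkl⟩))
    (hs : ∫ y, y ^ 2 ∂μ ⟨(k, l), hkl⟩ ≤ s) (i : Fin N) :
    ∫ x, rowWeight (symResolvent z (Function.update x ⟨(k, l), hkl⟩ 0)) i k l ∂Measure.pi μ ≤
      4 * ∫ x, rowWeight (symResolvent z x) i k l ∂Measure.pi μ := by
  set p : UpperIndex N := ⟨(k, l), hkl⟩
  set R := ∫ x, rowWeight (symResolvent z x) i k l ∂Measure.pi μ
  set R₀ := ∫ x, rowWeight (symResolvent z (Function.update x p 0)) i k l ∂Measure.pi μ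
  have hR₀ : 0 ≤ R₀ := integral_nonneg fun _ => rowWeight_nonneg _ _ _ _
  have hpointwise (x : UpperIndex N → ℝ) :
      rowWeight (symResolvent z (Function.update x p 0)) i k l ≤
        2 * rowWeight (symResolvent z x) i k l + 8 * |z.im|⁻¹ ^ 2 / N *
          (x p ^ 2 * rowWeight (symResolvent z (Function.update x p 0)) i k l) := by
    have h := rowWeight_le_of_norm_sub_le (norm_symResolvent_apply_le hz x)
      (norm_resolventMatrix_sub_update_le hz x hkl) i
    rw [abs_div_sqrt_sq] at h
    exact h.trans_eq (by unfold symResolvent; ring)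
  have hNpos : (0 : ℝ) < N := Nat.cast_pos.mpr (Fin.pos i)
  have habsorb : 8 * |z.im|⁻¹ ^ 2 / N * (s * R₀) ≤ R₀ / 2 :=
    calc 8 * |z.im|⁻¹ ^ 2 / N * (s * R₀) = 16 * s * |z.im|⁻¹ ^ 2 / N * (R₀ / 2) := by ring
      _ ≤ 1 * (R₀ / 2) := by
          gcongr
          exact (div_le_one hNpos).mpr hN
      _ = R₀ / 2 := one_mul _
  have hbound : R₀ ≤ 2 * R + 8 * |z.im|⁻¹ ^ 2 / N * (s * R₀) :=
    (integral_le_of_le_linear_combination (fun _ => rowWeight_nonneg _ _ _ _)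
      (integrable_rowWeight hz i k l) (integrable_mul_update p 0 h₂ (measurable_rowWeight hz i k l)
        (norm_rowWeight_symResolvent_le hz i k l)) hpointwise).trans
      (add_le_add_right (mul_le_mul_of_nonneg_left (integral_pow_mul_update_le hs
        (measurable_rowWeight hz i k l) fun _ => rowWeight_nonneg _ _ _ _) (by positivity)) _)
  linarith

theorem integral_pairWeight_update_le (hz : z.im ≠ 0)
    (h₂ : Integrable (fun y => y ^ 2) (μ ⟨(k, l), hkl⟩))
    (hs : ∫ y, y ^ 2 ∂μ ⟨(k, l), hkl⟩ ≤ s) (i j : Fin N) :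
    ∫ x, pairWeight (symResolvent z (Function.update x ⟨(k, l), hkl⟩ 0)) i j k l ∂Measure.pi μ ≤
      4 * ∫ x, pairWeight (symResolvent z x) i j k l ∂Measure.pi μ +
        24 * |z.im|⁻¹ ^ 4 / N * (s * ∫ x,
          rowWeight (symResolvent z (Function.update x ⟨(k, l), hkl⟩ 0)) i k l ∂Measure.pi μ) := by
  set p : UpperIndex N := ⟨(k, l), hkl⟩
  refine (integral_le_of_le_linear_combination (fun _ => pairWeight_nonneg _ _ _ _ _)
    (integrable_pairWeight hz i j k l) (integrable_mul_update p 0 h₂ (measurable_rowWeight hz i k l)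
      (norm_rowWeight_symResolvent_le hz i k l)) fun x => ?_).trans
    (add_le_add_right (mul_le_mul_of_nonneg_left (integral_pow_mul_update_le hs
      (measurable_rowWeight hz i k l) fun _ => rowWeight_nonneg _ _ _ _) (by positivity)) _)
  have h := pairWeight_le_of_norm_sub_le (norm_symResolvent_apply_le hz x)
    (norm_symResolvent_apply_le hz _) (norm_resolventMatrix_sub_update_le hz x hkl) i j
  rw [abs_div_sqrt_sq] at h
  exact h.trans_eq (by unfold symResolvent; ring)

theorem influence_le_rowWeight (hz : z.im ≠ 0) (hN : 16 * s * |z.im|⁻¹ ^ 2 ≤ N)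
    (h₂ : Integrable (fun y => y ^ 2) (μ ⟨(k, l), hkl⟩))
    (hs : ∫ y, y ^ 2 ∂μ ⟨(k, l), hkl⟩ ≤ s) (i j : Fin N) :
    ∫ x, ‖symResolvent z x i j - symResolvent z (Function.update x ⟨(k, l), hkl⟩ 0) i j‖ ^ 2
        ∂Measure.pi μ ≤
      8 * s * |z.im|⁻¹ ^ 2 / N * ∫ x, rowWeight (symResolvent z x) i k l ∂Measure.pi μ := by
  set p : UpperIndex N := ⟨(k, l), hkl⟩
  have hpointwise (x : UpperIndex N → ℝ) :
      ‖symResolvent z x i j - symResolvent z (Function.update x p 0) i j‖ ^ 2 ≤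
        2 * |z.im|⁻¹ ^ 2 / N *
          (x p ^ 2 * rowWeight (symResolvent z (Function.update x p 0)) i k l) := by
    have h := norm_sub_sq_le_rowWeight (norm_symResolvent_apply_le hz x)
      (norm_resolventMatrix_sub_update_le hz x hkl) i j
    rw [abs_div_sqrt_sq] at h
    exact h.trans_eq (by unfold symResolvent; ring)
  have hs₀ : 0 ≤ s := (integral_nonneg fun y => sq_nonneg y).trans hs
  calc ∫ x, ‖symResolvent z x i j - symResolvent z (Function.update x p 0) i j‖ ^ 2 ∂Measure.pi μ
      ≤ 2 * |z.im|⁻¹ ^ 2 / N *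
          ∫ x, x p ^ 2 * rowWeight (symResolvent z (Function.update x p 0)) i k l
            ∂Measure.pi μ := by
        rw [← integral_const_mul]
        exact integral_mono_of_nonneg (ae_of_all _ fun _ => sq_nonneg _)
          ((integrable_mul_update p 0 h₂ (measurable_rowWeight hz i k l)
            (norm_rowWeight_symResolvent_le hz i k l)).const_mul _) (ae_of_all _ hpointwise)
    _ ≤ 2 * |z.im|⁻¹ ^ 2 / N *
          (s * (4 * ∫ x, rowWeight (symResolvent z x) i k l ∂Measure.pi μ)) := by
        gcongr
        exact (integral_pow_mul_update_le hs (measurable_rowWeight hz i k l)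
          fun _ => rowWeight_nonneg _ _ _ _).trans
            (mul_le_mul_of_nonneg_left (integral_rowWeight_update_le hz hN h₂ hs i) hs₀)
    _ = _ := by ring

theorem influence_le_pairWeight (hz : z.im ≠ 0) (hN : 16 * s * |z.im|⁻¹ ^ 2 ≤ N)
    (h₂ : Integrable (fun y => y ^ 2) (μ ⟨(k, l), hkl⟩))
    (hs : ∫ y, y ^ 2 ∂μ ⟨(k, l), hkl⟩ ≤ s)
    (h₄ : Integrable (fun y => y ^ 4) (μ ⟨(k, l), hkl⟩))
    (hκ : ∫ y, y ^ 4 ∂μ ⟨(k, l), hkl⟩ ≤ κ) (i j : Fin N) :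
    ∫ x, ‖symResolvent z x i j - symResolvent z (Function.update x ⟨(k, l), hkl⟩ 0) i j‖ ^ 2
        ∂Measure.pi μ ≤
      16 * s / N * ∫ x, pairWeight (symResolvent z x) i j k l ∂Measure.pi μ +
        (384 * s ^ 2 + 64 * κ) * |z.im|⁻¹ ^ 4 / N ^ 2 *
          ∫ x, rowWeight (symResolvent z x) i k l ∂Measure.pi μ := by
  set p : UpperIndex N := ⟨(k, l), hkl⟩
  set R := ∫ x, rowWeight (symResolvent z x) i k l ∂Measure.pi μ
  set R₀ := ∫ x, rowWeight (symResolvent z (Function.update x p 0)) i k l ∂Measure.pi μ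
  set Q := ∫ x, pairWeight (symResolvent z x) i j k l ∂Measure.pi μ
  set Q₀ := ∫ x, pairWeight (symResolvent z (Function.update x p 0)) i j k l ∂Measure.pi μ
  have hpointwise (x : UpperIndex N → ℝ) :
      ‖symResolvent z x i j - symResolvent z (Function.update x p 0) i j‖ ^ 2 ≤
        4 / N * (x p ^ 2 * pairWeight (symResolvent z (Function.update x p 0)) i j k l) +
          16 * |z.im|⁻¹ ^ 4 / N ^ 2 *
            (x p ^ 4 * rowWeight (symResolvent z (Function.update x p 0)) i k l) := by
    have h := norm_sub_sq_le_pairWeight (norm_symResolvent_apply_le hz x)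
      (norm_symResolvent_apply_le hz _) (norm_resolventMatrix_sub_update_le hz x hkl) i j
    rw [show (|x p| / Real.sqrt N) ^ 4 = ((|x p| / Real.sqrt N) ^ 2) ^ 2 by ring,
      abs_div_sqrt_sq] at h
    exact h.trans_eq (by unfold symResolvent; ring)
  have hs₀ : 0 ≤ s := (integral_nonneg fun y => sq_nonneg y).trans hs
  have hκ₀ : 0 ≤ κ := (integral_nonneg fun y => by positivity).trans hκ
  have hR₀ : R₀ ≤ 4 * R := integral_rowWeight_update_le hz hN h₂ hs i
  have hQ₀ : Q₀ ≤ 4 * Q + 24 * |z.im|⁻¹ ^ 4 / N * (s * R₀) :=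
    integral_pairWeight_update_le hz h₂ hs i j
  calc _ ≤ 4 / N * ∫ x, x p ^ 2 *
            pairWeight (symResolvent z (Function.update x p 0)) i j k l ∂Measure.pi μ +
          16 * |z.im|⁻¹ ^ 4 / N ^ 2 * ∫ x, x p ^ 4 *
            rowWeight (symResolvent z (Function.update x p 0)) i k l ∂Measure.pi μ :=
        integral_le_of_le_linear_combination (fun _ => sq_nonneg _)
          (integrable_mul_update p 0 h₂ (measurable_pairWeight hz i j k l)
            (norm_pairWeight_symResolvent_le hz i j k l))
          (integrable_mul_update p 0 h₄ (measurable_rowWeight hz i k l)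
            (norm_rowWeight_symResolvent_le hz i k l)) hpointwise
    _ ≤ 4 / N * (s * Q₀) + 16 * |z.im|⁻¹ ^ 4 / N ^ 2 * (κ * R₀) := by
        gcongr
        · exact integral_pow_mul_update_le hs (measurable_pairWeight hz i j k l)
            fun _ => pairWeight_nonneg _ _ _ _ _
        · exact integral_pow_mul_update_le hκ (measurable_rowWeight hz i k l)
            fun _ => rowWeight_nonneg _ _ _ _
    _ ≤ 4 / N * (s * (4 * Q + 24 * |z.im|⁻¹ ^ 4 / N * (s * (4 * R)))) +
          16 * |z.im|⁻¹ ^ 4 / N ^ 2 * (κ * (4 * R)) := by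
        have hQ₀' := hQ₀.trans (add_le_add_right
          (mul_le_mul_of_nonneg_left (mul_le_mul_of_nonneg_left hR₀ hs₀) (by positivity)) _)
        gcongr
    _ = _ := by ring

end Influence

section Variance

variable {N : ℕ} {z : ℂ}

theorem opNorm_symResolvent_sq_le (hz : z.im ≠ 0) (x : UpperIndex N → ℝ) :
    opNorm (symResolvent z x) ^ 2 ≤ |z.im|⁻¹ ^ 2 :=
  pow_le_pow_left₀ (opNorm_nonneg _) (opNorm_symResolvent_le hz x) 2

theorem integrable_opNorm_symResolvent_sq {P : Measure (UpperIndex N → ℝ)} [IsFiniteMeasure P]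
    (hz : z.im ≠ 0) : Integrable (fun x => opNorm (symResolvent z x) ^ 2) P :=
  .of_bound ((continuous_opNorm.comp (continuous_resolventMatrix_symMatrix hz)).pow
    2).measurable.aestronglyMeasurable (|z.im|⁻¹ ^ 2)
    (ae_of_all _ fun x => (Real.norm_of_nonneg (sq_nonneg _)).trans_le
      (opNorm_symResolvent_sq_le hz x))

theorem sum_integral_le {ι Ω : Type*} [Fintype ι] [MeasurableSpace Ω] {P : Measure Ω}
    {f : ι → Ω → ℝ} {g : Ω → ℝ} {c : ℝ} (hf : ∀ i, Integrable (f i) P) (hg : Integrable g P)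
    (h : ∀ ω, ∑ i, f i ω ≤ c * g ω) : ∑ i, ∫ ω, f i ω ∂P ≤ c * ∫ ω, g ω ∂P := by
  rw [← integral_finsetSum _ fun i _ => hf i, ← integral_const_mul]
  exact integral_mono (integrable_finsetSum _ fun i _ => hf i) (hg.const_mul c) h

theorem sum_upperIndex_le {f : Fin N × Fin N → ℝ} (hf : ∀ q, 0 ≤ f q) :
    ∑ p : UpperIndex N, f p.1 ≤ ∑ q, f q := by
  rw [← Finset.sum_subtype (Finset.univ.filter fun q : Fin N × Fin N => q.1 ≤ q.2) (by simp) f]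
  exact Finset.sum_le_univ_sum_of_nonneg hf

section Sums

variable {P : Measure (UpperIndex N → ℝ)} [IsFiniteMeasure P]

theorem sum_integral_rowWeight_diag_le (hz : z.im ≠ 0) (i : Fin N) :
    ∑ k, ∫ x, rowWeight (symResolvent z x) i k k ∂P ≤
      2 * ∫ x, opNorm (symResolvent z x) ^ 2 ∂P := by
  refine sum_integral_le (fun k => integrable_rowWeight hz i k k)
    (integrable_opNorm_symResolvent_sq hz) fun x => ?_
  rw [sum_rowWeight_diag]
  gcongr
  exact sum_norm_sq_row_le_opNorm_sq (isSymm_symResolvent x) i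

theorem sum_integral_rowWeight_le (hz : z.im ≠ 0) (i : Fin N) :
    ∑ q : Fin N × Fin N, ∫ x, rowWeight (symResolvent z x) i q.1 q.2 ∂P ≤
      2 * N * ∫ x, opNorm (symResolvent z x) ^ 2 ∂P := by
  refine sum_integral_le (fun q => integrable_rowWeight hz i q.1 q.2)
    (integrable_opNorm_symResolvent_sq hz) fun x => ?_
  rw [Fintype.sum_prod_type, sum_rowWeight]
  gcongr
  exact sum_norm_sq_row_le_opNorm_sq (isSymm_symResolvent x) i

theorem sum_integral_pairWeight_le (hz : z.im ≠ 0) (i j : Fin N) :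
    ∑ q : Fin N × Fin N, ∫ x, pairWeight (symResolvent z x) i j q.1 q.2 ∂P ≤
      2 * |z.im|⁻¹ ^ 2 * ∫ x, opNorm (symResolvent z x) ^ 2 ∂P := by
  refine sum_integral_le (fun q => integrable_pairWeight hz i j q.1 q.2)
    (integrable_opNorm_symResolvent_sq hz) fun x => ?_
  rw [Fintype.sum_prod_type, sum_pairWeight, mul_assoc, mul_assoc]
  gcongr
  · exact (sum_norm_sq_row_le_opNorm_sq (isSymm_symResolvent x) i).trans
      (opNorm_symResolvent_sq_le hz x)
  · exact sum_norm_sq_col_le_opNorm_sq _ j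

end Sums

variable {μ : UpperIndex N → Measure ℝ} [∀ p, IsProbabilityMeasure (μ p)] {s κ : ℝ}

theorem influence_le (hz : z.im ≠ 0) (hN : 16 * s * |z.im|⁻¹ ^ 2 ≤ N) (hκ₀ : 0 ≤ κ)
    (h₂ : ∀ p, Integrable (fun y => y ^ 2) (μ p)) (hs : ∀ p, ∫ y, y ^ 2 ∂μ p ≤ s)
    (h₄ : ∀ p, p.1.1 ≠ p.1.2 → Integrable (fun y => y ^ 4) (μ p))
    (hκ : ∀ p, p.1.1 ≠ p.1.2 → ∫ y, y ^ 4 ∂μ p ≤ κ) (i j : Fin N) (p : UpperIndex N) :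
    ∫ x, ‖symResolvent z x i j - symResolvent z (Function.update x p 0) i j‖ ^ 2 ∂Measure.pi μ ≤
      16 * s / N * ∫ x, pairWeight (symResolvent z x) i j p.1.1 p.1.2 ∂Measure.pi μ +
        (384 * s ^ 2 + 64 * κ) * |z.im|⁻¹ ^ 4 / N ^ 2 *
          ∫ x, rowWeight (symResolvent z x) i p.1.1 p.1.2 ∂Measure.pi μ +
        if p.1.1 = p.1.2 then 8 * s * |z.im|⁻¹ ^ 2 / N *
          ∫ x, rowWeight (symResolvent z x) i p.1.1 p.1.1 ∂Measure.pi μ else 0 := by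
  obtain ⟨⟨k, l⟩, hkl⟩ := p
  have hs₀ : 0 ≤ s := (integral_nonneg fun y => sq_nonneg y).trans (hs ⟨(k, l), hkl⟩)
  split_ifs with hdiag
  · obtain rfl : k = l := hdiag
    have hpair : 0 ≤ ∫ x, pairWeight (symResolvent z x) i j k k ∂Measure.pi μ :=
      integral_nonneg fun _ => pairWeight_nonneg _ _ _ _ _
    have hrow : 0 ≤ ∫ x, rowWeight (symResolvent z x) i k k ∂Measure.pi μ :=
      integral_nonneg fun _ => rowWeight_nonneg _ _ _ _
    exact (influence_le_rowWeight hz hN (h₂ _) (hs _) i j).trans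
      (le_add_of_nonneg_left (by positivity))
  · rw [add_zero]
    exact influence_le_pairWeight hz hN (h₂ _) (hs _) (h₄ _ hdiag) (hκ _ hdiag) i j

theorem variance_symResolvent_le_of_le (hz : z.im ≠ 0) (hN : 16 * s * |z.im|⁻¹ ^ 2 ≤ N)
    (hκ₀ : 0 ≤ κ)
    (h₂ : ∀ p, Integrable (fun y => y ^ 2) (μ p)) (hs : ∀ p, ∫ y, y ^ 2 ∂μ p ≤ s)
    (h₄ : ∀ p, p.1.1 ≠ p.1.2 → Integrable (fun y => y ^ 4) (μ p))
    (hκ : ∀ p, p.1.1 ≠ p.1.2 → ∫ y, y ^ 4 ∂μ p ≤ κ) (i j : Fin N) :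
    ∫ x, ‖symResolvent z x i j - ∫ y, symResolvent z y i j ∂Measure.pi μ‖ ^ 2 ∂Measure.pi μ ≤
      (48 * s * |z.im|⁻¹ ^ 2 + (768 * s ^ 2 + 128 * κ) * |z.im|⁻¹ ^ 4) *
        (∫ x, opNorm (symResolvent z x) ^ 2 ∂Measure.pi μ) / N := by
  set t := |z.im|⁻¹
  set V := ∫ x, opNorm (symResolvent z x) ^ 2 ∂Measure.pi μ
  have hs₀ : 0 ≤ s := (integral_nonneg fun y => sq_nonneg y).trans (hs ⟨(i, i), le_rfl⟩)
  have hNpos : (0 : ℝ) < N := Nat.cast_pos.mpr (Fin.pos i)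
  let row (k l : Fin N) : ℝ := ∫ x, rowWeight (symResolvent z x) i k l ∂Measure.pi μ
  let pair (k l : Fin N) : ℝ := ∫ x, pairWeight (symResolvent z x) i j k l ∂Measure.pi μ
  have hrow₀ (k l : Fin N) : 0 ≤ row k l := integral_nonneg fun _ => rowWeight_nonneg _ _ _ _
  have hpair₀ (k l : Fin N) : 0 ≤ pair k l :=
    integral_nonneg fun _ => pairWeight_nonneg _ _ _ _ _
  calc _ ≤ _ := efronStein 0 μ (measurable_symResolvent_apply hz i j).stronglyMeasurable
        fun x => norm_symResolvent_apply_le hz x i j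
    _ ≤ _ := Finset.sum_le_sum fun p _ => influence_le hz hN hκ₀ h₂ hs h₄ hκ i j p
    _ ≤ ∑ q : Fin N × Fin N, (16 * s / N * pair q.1 q.2 +
          (384 * s ^ 2 + 64 * κ) * t ^ 4 / N ^ 2 * row q.1 q.2 +
          if q.1 = q.2 then 8 * s * t ^ 2 / N * row q.1 q.1 else 0) :=
        sum_upperIndex_le (f := fun q => 16 * s / N * pair q.1 q.2 +
          (384 * s ^ 2 + 64 * κ) * t ^ 4 / N ^ 2 * row q.1 q.2 +
          if q.1 = q.2 then 8 * s * t ^ 2 / N * row q.1 q.1 else 0) fun q => by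
            have := hrow₀ q.1 q.2
            have := hrow₀ q.1 q.1
            have := hpair₀ q.1 q.2
            split_ifs <;> positivity
    _ = 16 * s / N * ∑ q : Fin N × Fin N, pair q.1 q.2 +
          (384 * s ^ 2 + 64 * κ) * t ^ 4 / N ^ 2 * ∑ q : Fin N × Fin N, row q.1 q.2 +
          8 * s * t ^ 2 / N * ∑ k, row k k := by
        rw [Finset.sum_add_distrib, Finset.sum_add_distrib, ← Finset.mul_sum, ← Finset.mul_sum,
          Fintype.sum_prod_type (fun q : Fin N × Fin N => ite _ _ _)]
        simp only [Finset.sum_ite_eq, Finset.mem_univ, if_true, ← Finset.mul_sum]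
    _ ≤ 16 * s / N * (2 * t ^ 2 * V) +
          (384 * s ^ 2 + 64 * κ) * t ^ 4 / N ^ 2 * (2 * N * V) + 8 * s * t ^ 2 / N * (2 * V) := by
        gcongr
        · exact sum_integral_pairWeight_le hz i j
        · exact sum_integral_rowWeight_le hz i
        · exact sum_integral_rowWeight_diag_le hz i
    _ = _ := by
        field_simp
        ring

theorem variance_symResolvent_le_integral_opNorm_sq (hz : z.im ≠ 0)
    {P : Measure (UpperIndex N → ℝ)} [IsProbabilityMeasure P] (i j : Fin N) :
    ∫ x, ‖symResolvent z x i j - ∫ y, symResolvent z y i j ∂P‖ ^ 2 ∂P ≤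
      ∫ x, opNorm (symResolvent z x) ^ 2 ∂P := by
  have hbounded : MemLp (fun x => symResolvent z x i j) 2 P :=
    .of_bound (measurable_symResolvent_apply hz i j).aestronglyMeasurable _
      (ae_of_all _ fun x => norm_symResolvent_apply_le hz x i j)
  refine (integral_norm_sub_integral_sq_le hbounded 0).trans ?_
  simp only [sub_zero]
  exact integral_mono_of_nonneg (ae_of_all _ fun _ => sq_nonneg _)
    (integrable_opNorm_symResolvent_sq hz)
    (ae_of_all _ fun x => pow_le_pow_left₀ (norm_nonneg _) (norm_apply_le_opNorm _ i j) 2)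

theorem variance_symResolvent_le (hz : z.im ≠ 0) (hκ₀ : 0 ≤ κ)
    (h₂ : ∀ p, Integrable (fun y => y ^ 2) (μ p)) (hs : ∀ p, ∫ y, y ^ 2 ∂μ p ≤ s)
    (h₄ : ∀ p, p.1.1 ≠ p.1.2 → Integrable (fun y => y ^ 4) (μ p))
    (hκ : ∀ p, p.1.1 ≠ p.1.2 → ∫ y, y ^ 4 ∂μ p ≤ κ) (i j : Fin N) :
    ∫ x, ‖symResolvent z x i j - ∫ y, symResolvent z y i j ∂Measure.pi μ‖ ^ 2 ∂Measure.pi μ ≤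
      (48 * s * |z.im|⁻¹ ^ 2 + (768 * s ^ 2 + 128 * κ) * |z.im|⁻¹ ^ 4) *
        (∫ x, opNorm (symResolvent z x) ^ 2 ∂Measure.pi μ) / N := by
  have hs₀ : 0 ≤ s := (integral_nonneg fun y => sq_nonneg y).trans (hs ⟨(i, i), le_rfl⟩)
  rcases le_total (16 * s * |z.im|⁻¹ ^ 2) (N : ℝ) with hN | hN
  · exact variance_symResolvent_le_of_le hz hN hκ₀ h₂ hs h₄ hκ i j
  · refine (variance_symResolvent_le_integral_opNorm_sq hz i j).trans ?_
    have hNpos : (0 : ℝ) < N := Nat.cast_pos.mpr (Fin.pos i)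
    have hcoef : (N : ℝ) ≤
        48 * s * |z.im|⁻¹ ^ 2 + (768 * s ^ 2 + 128 * κ) * |z.im|⁻¹ ^ 4 := by
      have : 0 ≤ s * |z.im|⁻¹ ^ 2 := by positivity
      have : 0 ≤ (768 * s ^ 2 + 128 * κ) * |z.im|⁻¹ ^ 4 := by positivity
      linarith
    rw [le_div_iff₀ hNpos, mul_comm]
    exact mul_le_mul_of_nonneg_right hcoef (integral_nonneg fun _ => sq_nonneg _)

end Variance

/-- The law of the entry of a random matrix in position `p`. -/
noncomputable def entryLaw {Ω : Type*} [MeasurableSpace Ω] {N : ℕ} (P : Measure Ω)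
    (A : Ω → Matrix (Fin N) (Fin N) ℝ) (p : UpperIndex N) : Measure ℝ :=
  P.map fun ω => A ω p.1.1 p.1.2

theorem integrable_pow_four_of_memLp {μ : Measure ℝ} (h : MemLp id 4 μ) :
    Integrable (fun x => x ^ 4) μ := by
  simpa [Real.norm_eq_abs, Even.pow_abs (by decide : Even 4)] using
    h.integrable_norm_pow four_ne_zero

namespace IsWigner

variable {Ω : ℕ → Type u} [∀ N, MeasurableSpace (Ω N)] {P : ∀ N, Measure (Ω N)}
  {W : ∀ N, Ω N → Matrix (Fin N) (Fin N) ℝ} {σ σ₁ m₄ : ℝ}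

theorem integral_eq_zero (hW : IsWigner P W σ σ₁ m₄) (N : ℕ) (j k : Fin N) :
    ∫ ω, W N ω j k ∂(P N) = 0 := by
  rcases eq_or_ne j k with rfl | h
  · exact hW.diag_mean N j
  · exact hW.offDiag_mean N j k h

theorem measurable_entries (hW : IsWigner P W σ σ₁ m₄) (N : ℕ) :
    Measurable fun ω (p : UpperIndex N) => W N ω p.1.1 p.1.2 :=
  measurable_pi_lambda _ fun _ => hW.measurable_entry N _ _

theorem integral_entryLaw {N : ℕ} {p : UpperIndex N} (hW : IsWigner P W σ σ₁ m₄) {f : ℝ → ℝ}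
    (hf : Measurable f) : ∫ x, f x ∂entryLaw (P N) (W N) p = ∫ ω, f (W N ω p.1.1 p.1.2) ∂(P N) :=
  integral_map (hW.measurable_entry N _ _).aemeasurable hf.aestronglyMeasurable

theorem integral_entryLaw_eq_zero (hW : IsWigner P W σ σ₁ m₄) (N : ℕ) (p : UpperIndex N) :
    ∫ x, x ∂entryLaw (P N) (W N) p = 0 :=
  (hW.integral_entryLaw measurable_id').trans (hW.integral_eq_zero N _ _)

theorem memLp_four_entryLaw {N : ℕ} {p : UpperIndex N} (hW : IsWigner P W σ σ₁ m₄)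
    (hp : p.1.1 ≠ p.1.2) : MemLp id 4 (entryLaw (P N) (W N) p) :=
  (memLp_map_measure_iff aestronglyMeasurable_id
    (hW.measurable_entry N _ _).aemeasurable).mpr (hW.offDiag_memLp N _ _ hp)

theorem integral_pow_four_entryLaw_le {N : ℕ} {p : UpperIndex N} (hW : IsWigner P W σ σ₁ m₄)
    (hp : p.1.1 ≠ p.1.2) : ∫ x, x ^ 4 ∂entryLaw (P N) (W N) p ≤ m₄ :=
  (hW.integral_entryLaw (measurable_id.pow_const 4)).trans_le (hW.offDiag_fourth N _ _ hp)

theorem integral_offDiag_sq (hW : IsWigner P W σ σ₁ m₄) (N : ℕ) {j k : Fin N} (h : j ≠ k) :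
    ∫ ω, W N ω j k ^ 2 ∂(P N) = σ ^ 2 := by
  rw [← hW.offDiag_variance N j k h,
    variance_of_integral_eq_zero (hW.measurable_entry N j k).aemeasurable (hW.offDiag_mean N j k h)]

theorem integral_sq_entryLaw_le (hW : IsWigner P W σ σ₁ m₄) (N : ℕ) (p : UpperIndex N) :
    ∫ x, x ^ 2 ∂entryLaw (P N) (W N) p ≤ σ ^ 2 + σ₁ ^ 2 := by
  refine (hW.integral_entryLaw (measurable_id.pow_const 2)).trans_le ?_
  obtain ⟨⟨j, k⟩, _⟩ := p
  rcases eq_or_ne j k with rfl | h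
  · exact (hW.diag_second N j).trans (le_add_of_nonneg_left (sq_nonneg _))
  · exact (hW.integral_offDiag_sq N h).trans_le (le_add_of_nonneg_right (sq_nonneg _))

variable [∀ N, IsProbabilityMeasure (P N)]

theorem memLp_two (hW : IsWigner P W σ σ₁ m₄) (N : ℕ) (j k : Fin N) :
    MemLp (fun ω => W N ω j k) 2 (P N) := by
  rcases eq_or_ne j k with rfl | h
  · exact hW.diag_memLp N j
  · exact (hW.offDiag_memLp N j k h).mono_exponent (by norm_num)

theorem isProbabilityMeasure_entryLaw (hW : IsWigner P W σ σ₁ m₄) (N : ℕ) (p : UpperIndex N) :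
    IsProbabilityMeasure (entryLaw (P N) (W N) p) :=
  Measure.isProbabilityMeasure_map (hW.measurable_entry N _ _).aemeasurable

theorem memLp_two_entryLaw (hW : IsWigner P W σ σ₁ m₄) (N : ℕ) (p : UpperIndex N) :
    MemLp id 2 (entryLaw (P N) (W N) p) :=
  (memLp_map_measure_iff aestronglyMeasurable_id
    (hW.measurable_entry N _ _).aemeasurable).mpr (hW.memLp_two N _ _)

theorem map_entries_eq_pi (hW : IsWigner P W σ σ₁ m₄) (N : ℕ) :
    (P N).map (fun ω (p : UpperIndex N) => W N ω p.1.1 p.1.2) =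
      Measure.pi (entryLaw (P N) (W N)) :=
  (iIndepFun_iff_map_fun_eq_pi_map fun _ => (hW.measurable_entry N _ _).aemeasurable).mp
    (hW.indep N)

theorem integral_resolventMatrix_eq {E : Type*} [NormedAddCommGroup E] [NormedSpace ℝ E]
    (hW : IsWigner P W σ σ₁ m₄) (N : ℕ) {z : ℂ} (hz : z.im ≠ 0)
    {f : Matrix (Fin N) (Fin N) ℂ → E} (hf : Continuous f) :
    ∫ ω, f (resolventMatrix (W N ω) z) ∂(P N) =
      ∫ x, f (symResolvent z x) ∂Measure.pi (entryLaw (P N) (W N)) := by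
  have hmeas : AEStronglyMeasurable (fun x => f (symResolvent z x))
      ((P N).map fun ω (p : UpperIndex N) => W N ω p.1.1 p.1.2) :=
    (hf.comp (continuous_resolventMatrix_symMatrix hz)).aestronglyMeasurable
  rw [← hW.map_entries_eq_pi, integral_map (hW.measurable_entries N).aemeasurable hmeas]
  simp only [symResolvent, symMatrix_of_isSymm (hW.isSymm N _)]

theorem cVariance_resolventMatrix_le (hW : IsWigner P W σ σ₁ m₄) {N : ℕ} (i j : Fin N) {z : ℂ}
    (hz : z.im ≠ 0) :
    cVariance (P N) (fun ω => resolventMatrix (W N ω) z i j) ≤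
      (48 * (σ ^ 2 + σ₁ ^ 2) * |z.im|⁻¹ ^ 2 +
        (768 * (σ ^ 2 + σ₁ ^ 2) ^ 2 + 128 * |m₄|) * |z.im|⁻¹ ^ 4) *
      (∫ ω, opNorm (resolventMatrix (W N ω) z) ^ 2 ∂(P N)) / N := by
  have := hW.isProbabilityMeasure_entryLaw N
  have happly : Continuous fun M : Matrix (Fin N) (Fin N) ℂ => M i j :=
    continuous_id.matrix_elem i j
  rw [cVariance, hW.integral_resolventMatrix_eq N hz (f := fun M => M i j) happly,
    hW.integral_resolventMatrix_eq N hz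
      (f := fun M => ‖M i j - ∫ x, symResolvent z x i j ∂Measure.pi (entryLaw (P N) (W N))‖ ^ 2)
      ((happly.sub continuous_const).norm.pow 2),
    hW.integral_resolventMatrix_eq N hz (f := fun M => opNorm M ^ 2) (continuous_opNorm.pow 2)]
  exact variance_symResolvent_le hz (abs_nonneg m₄)
    (fun p => (hW.memLp_two_entryLaw N p).integrable_sq) (hW.integral_sq_entryLaw_le N)
    (fun p hp => integrable_pow_four_of_memLp (hW.memLp_four_entryLaw hp))
    (fun p hp => (hW.integral_pow_four_entryLaw_le hp).trans (le_abs_self m₄)) i j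

end IsWigner

/-- The extra randomness used to truncate one entry: `keep` leaves a small value unchanged, `up` and
`down` replace the value by a fixed positive, respectively negative, number. -/
inductive Noise : Type u
  | keep
  | up
  | down

namespace Noise

instance : MeasurableSpace Noise.{u} := ⊤

instance : Countable Noise.{u} :=
  ⟨⟨fun | keep => 0 | up => 1 | down => 2, by rintro ⟨⟩ ⟨⟩ <;> simp⟩⟩

instance : DiscreteMeasurableSpace Noise.{u} := ⟨fun _ => trivial⟩

/-- The law of the extra randomness: the value is replaced with probability `q`, and `b` is the
probability of `up` minus the one of `down`. -/
noncomputable def law (q b : ℝ) : Measure Noise.{u} :=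
  ENNReal.ofReal (1 - q) • Measure.dirac keep + (ENNReal.ofReal ((q + b) / 2) • Measure.dirac up +
    ENNReal.ofReal ((q - b) / 2) • Measure.dirac down)

variable {q b : ℝ}

theorem isProbabilityMeasure_law (hq : q ≤ 1) (hb : |b| ≤ q) :
    IsProbabilityMeasure (law.{u} q b) := by
  obtain ⟨hb₁, hb₂⟩ := abs_le.mp hb
  refine ⟨?_⟩
  simp only [law, Measure.coe_add, Measure.coe_smul, Pi.add_apply, Pi.smul_apply, measure_univ,
    smul_eq_mul, mul_one]
  rw [← ENNReal.ofReal_add (by linarith) (by linarith),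
    ← ENNReal.ofReal_add (by linarith) (by linarith), ENNReal.ofReal_eq_one]
  ring

theorem integral_law (hq : q ≤ 1) (hb : |b| ≤ q) (g : Noise.{u} → ℝ) :
    ∫ c, g c ∂law q b = (1 - q) * g keep + ((q + b) / 2 * g up + (q - b) / 2 * g down) := by
  obtain ⟨hb₁, hb₂⟩ := abs_le.mp hb
  have hg : ∀ (a : ℝ) (c : Noise.{u}), Integrable g (ENNReal.ofReal a • Measure.dirac c) :=
    fun a c => (integrable_dirac (by simp)).smul_measure ENNReal.ofReal_ne_top
  rw [law, integral_add_measure (hg _ _) ((hg _ _).add_measure (hg _ _)),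
    integral_add_measure (hg _ _) (hg _ _)]
  simp only [integral_smul_measure, integral_dirac, smul_eq_mul]
  rw [ENNReal.toReal_ofReal (by linarith), ENNReal.toReal_ofReal (by linarith),
    ENNReal.toReal_ofReal (by linarith)]

theorem law_real_keep (hq : q ≤ 1) : (law.{u} q b).real {keep} = 1 - q := by
  simp [law, measureReal_def, hq]

end Noise

/-- Keep `x` if `|x| < L` and the extra randomness does not ask for a replacement by `y` or `-y`;
a large `x` that is not replaced becomes `0`. -/
noncomputable def replaceLarge (L y : ℝ) : ℝ × Noise.{u} → ℝ
  | (x, .keep) => {x | |x| < L}.indicator id x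
  | (_, .up) => y
  | (_, .down) => -y

theorem measurableSet_abs_lt (L : ℝ) : MeasurableSet {x : ℝ | |x| < L} :=
  measurableSet_lt measurable_id.abs measurable_const

theorem compl_setOf_abs_lt (L : ℝ) : {x : ℝ | |x| < L}ᶜ = {x | L ≤ |x|} := by
  simp only [Set.compl_ofPred, not_lt]

theorem measurable_replaceLarge (L y : ℝ) : Measurable (replaceLarge.{u} L y) := by
  refine measurable_from_prod_countable_left fun c => ?_
  rcases c with _ | _ | _
  · exact measurable_id.indicator (measurableSet_abs_lt L)
  · exact measurable_const
  · exact measurable_const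

theorem abs_replaceLarge_le {L y : ℝ} (hL : 0 ≤ L) (hy : |y| ≤ 2 * L) (x : ℝ × Noise.{u}) :
    |replaceLarge L y x| ≤ 2 * L := by
  obtain ⟨x, _ | _ | _⟩ := x
  · by_cases hx : |x| < L
    · simpa [replaceLarge, hx] using hx.le.trans (by linarith)
    · simpa [replaceLarge, hx] using hL
  · exact hy
  · exact (abs_neg y).trans_le hy

theorem integral_replaceLarge_pow {μ : Measure ℝ} [IsProbabilityMeasure μ] {L y q b : ℝ}
    (hL : 0 ≤ L) (hy : |y| ≤ 2 * L) (hq : q ≤ 1) (hb : |b| ≤ q) {n : ℕ} (hn : n ≠ 0) :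
    ∫ x, replaceLarge L y x ^ n ∂μ.prod (Noise.law.{u} q b) =
      (1 - q) * ∫ x in {x | |x| < L}, x ^ n ∂μ +
        ((q + b) / 2 * y ^ n + (q - b) / 2 * (-y) ^ n) := by
  have := Noise.isProbabilityMeasure_law.{u} hq hb
  have hint : Integrable (fun x => replaceLarge.{u} L y x ^ n) (μ.prod (Noise.law q b)) := by
    refine Integrable.of_bound ((measurable_replaceLarge L y).pow_const n).aestronglyMeasurable
      ((2 * L) ^ n) (ae_of_all _ fun x => ?_)
    rw [norm_pow]
    exact pow_le_pow_left₀ (norm_nonneg _) (abs_replaceLarge_le hL hy x) n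
  have hkeep (x : ℝ) : replaceLarge.{u} L y (x, .keep) ^ n =
      {x | |x| < L}.indicator (fun x => x ^ n) x := by
    by_cases hx : |x| < L <;> simp [replaceLarge, hx, hn]
  rw [integral_prod_symm _ hint, Noise.integral_law hq hb]
  simp_rw [hkeep, integral_indicator (measurableSet_abs_lt L)]
  simp only [replaceLarge, integral_const, probReal_univ, one_smul]

theorem measureReal_replaceLarge_ne_le {μ : Measure ℝ} [IsProbabilityMeasure μ] {L y q b : ℝ}
    (hq : q ≤ 1) (hb : |b| ≤ q) :
    (μ.prod (Noise.law.{u} q b)).real {x | replaceLarge L y x ≠ x.1} ≤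
      μ.real {x | L ≤ |x|} + q := by
  have := Noise.isProbabilityMeasure_law.{u} hq hb
  have hS := measurableSet_abs_lt L
  have hsub : {x : ℝ × Noise.{u} | replaceLarge L y x ≠ x.1} ⊆ ({x | |x| < L} ×ˢ {.keep})ᶜ := by
    rintro ⟨x, c⟩ hx ⟨hxL : |x| < L, rfl : c = .keep⟩
    exact hx (by simp [replaceLarge, hxL])
  calc _ ≤ (μ.prod (Noise.law.{u} q b)).real ({x | |x| < L} ×ˢ {.keep})ᶜ := measureReal_mono hsub
    _ = 1 - μ.real {x | |x| < L} * (1 - q) := by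
      rw [probReal_compl_eq_one_sub (hS.prod (measurableSet_singleton _)), measureReal_prod_prod,
        Noise.law_real_keep hq]
    _ ≤ 1 - μ.real {x | |x| < L} + q := by
      nlinarith [measureReal_le_one (μ := μ) (s := {x : ℝ | |x| < L}), abs_nonneg b]
    _ = _ := by rw [← compl_setOf_abs_lt, probReal_compl_eq_one_sub hS]

/-- A transformation `τ` of an entry with law `μ`, which may use extra randomness with law `ν`,
preserves the first two moments, and at most multiplies the fourth one by `4`. -/
structure PreservesMoments {C : Type*} [MeasurableSpace C] (μ : Measure ℝ) (ν : Measure C)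
    (τ : ℝ × C → ℝ) : Prop where
  measurable : Measurable τ
  memLp_two : MemLp τ 2 (μ.prod ν)
  memLp_four : MemLp id 4 μ → MemLp τ 4 (μ.prod ν)
  integral_eq : ∫ x, τ x ∂μ.prod ν = ∫ x, x ∂μ
  integral_sq_eq : ∫ x, τ x ^ 2 ∂μ.prod ν = ∫ x, x ^ 2 ∂μ
  integral_pow_four_le : MemLp id 4 μ → ∫ x, τ x ^ 4 ∂μ.prod ν ≤ 4 * ∫ x, x ^ 4 ∂μ

theorem preservesMoments_fst {C : Type*} [MeasurableSpace C] {μ : Measure ℝ} {ν : Measure C}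
    [SFinite μ] [IsProbabilityMeasure ν] (hμ : MemLp id 2 μ) :
    PreservesMoments μ ν Prod.fst where
  measurable := measurable_fst
  memLp_two := hμ.comp_fst ν
  memLp_four h := h.comp_fst ν
  integral_eq := by simpa using integral_fun_fst (μ := μ) (ν := ν) fun x => x
  integral_sq_eq := by simpa using integral_fun_fst (μ := μ) (ν := ν) fun x => x ^ 2
  integral_pow_four_le _ := by
    have h := integral_fun_fst (μ := μ) (ν := ν) fun x => x ^ 4
    simp only [probReal_univ, one_smul] at h
    rw [h]
    exact le_mul_of_one_le_left (integral_nonneg fun x => by positivity) (by norm_num)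

theorem pow_mul_setIntegral_le {Ω : Type*} [MeasurableSpace Ω] {P : Measure Ω} {X : Ω → ℝ}
    (hX : Measurable X) {L : ℝ} (hL : 0 ≤ L) {k n : ℕ} (hk : Even k) (hn : Even n)
    (hi : Integrable (fun ω => X ω ^ n) P) (hi' : Integrable (fun ω => X ω ^ (k + n)) P) :
    L ^ k * ∫ ω in {ω | L ≤ |X ω|}, X ω ^ n ∂P ≤ ∫ ω in {ω | L ≤ |X ω|}, X ω ^ (k + n) ∂P := by
  rw [← integral_const_mul]
  refine setIntegral_mono_on (hi.const_mul _).integrableOn hi'.integrableOn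
    (measurableSet_le measurable_const hX.abs) fun ω (hω : L ≤ |X ω|) => ?_
  rw [pow_add, ← hk.pow_abs (X ω)]
  exact mul_le_mul_of_nonneg_right (pow_le_pow_left₀ hL hω k) (hn.pow_nonneg _)

section Truncation

variable (μ : Measure ℝ) (L : ℝ)

/-- The probability with which truncation at level `L` replaces a value regardless of its size. -/
noncomputable def replaceProb : ℝ :=
  (∫ x in {x | L ≤ |x|}, x ^ 2 ∂μ) / L ^ 2

/-- The absolute value of the replacements in the truncation at level `L`; it is chosen such that
the second moment is preserved. -/
noncomputable def replaceValue : ℝ :=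
  √(L ^ 2 + ∫ x in {x | |x| < L}, x ^ 2 ∂μ)

/-- The bias of the sign of the replacements in the truncation at level `L`; it is chosen such that
the mean is preserved. -/
noncomputable def replaceBias : ℝ :=
  -((1 - replaceProb μ L) * ∫ x in {x | |x| < L}, x ∂μ) / replaceValue μ L

/-- The truncation at level `L` of a variable with law `μ`; its values are at most `2 * L`. -/
noncomputable def truncate : ℝ × Noise.{u} → ℝ :=
  replaceLarge L (replaceValue μ L)

/-- The law of the extra randomness used by `truncate μ L`. -/
noncomputable def truncationNoise : Measure Noise.{u} :=
  Noise.law (replaceProb μ L) (replaceBias μ L)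

variable {μ L}

theorem setIntegral_abs_lt_add {n : ℕ} (h : Integrable (fun x => x ^ n) μ) :
    ∫ x in {x | |x| < L}, x ^ n ∂μ + ∫ x in {x | L ≤ |x|}, x ^ n ∂μ = ∫ x, x ^ n ∂μ := by
  rw [← compl_setOf_abs_lt]
  exact integral_add_compl (measurableSet_abs_lt L) h

theorem replaceProb_nonneg : 0 ≤ replaceProb μ L :=
  div_nonneg (integral_nonneg fun x => sq_nonneg x) (sq_nonneg L)

theorem replaceProb_mul_sq (hL : 0 < L) :
    replaceProb μ L * L ^ 2 = ∫ x in {x | L ≤ |x|}, x ^ 2 ∂μ :=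
  div_mul_cancel₀ _ (by positivity)

theorem replaceValue_sq : replaceValue μ L ^ 2 = L ^ 2 + ∫ x in {x | |x| < L}, x ^ 2 ∂μ :=
  Real.sq_sqrt (add_nonneg (sq_nonneg L) (integral_nonneg fun x => sq_nonneg x))

theorem le_replaceValue : L ≤ replaceValue μ L :=
  Real.le_sqrt_of_sq_le (le_add_of_nonneg_right (integral_nonneg fun x => sq_nonneg x))

theorem replaceProb_le_one (hi : Integrable (fun x => x ^ 2) μ) (hv : ∫ x, x ^ 2 ∂μ ≤ L ^ 2) :
    replaceProb μ L ≤ 1 :=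
  div_le_one_of_le₀ ((setIntegral_le_integral hi (ae_of_all _ fun x => sq_nonneg x)).trans hv)
    (sq_nonneg L)

theorem replaceValue_sq_le (hi : Integrable (fun x => x ^ 2) μ) (hv : ∫ x, x ^ 2 ∂μ ≤ L ^ 2) :
    replaceValue μ L ^ 2 ≤ 2 * L ^ 2 := by
  have h := setIntegral_le_integral (s := {x | |x| < L}) hi (ae_of_all _ fun x => sq_nonneg x)
  rw [replaceValue_sq]
  linarith

theorem abs_replaceValue_le (hL : 0 ≤ L) (hi : Integrable (fun x => x ^ 2) μ)
    (hv : ∫ x, x ^ 2 ∂μ ≤ L ^ 2) : |replaceValue μ L| ≤ 2 * L :=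
  abs_le_of_sq_le_sq ((replaceValue_sq_le hi hv).trans (by nlinarith [sq_nonneg L])) (by positivity)

theorem abs_setIntegral_abs_lt_le [IsFiniteMeasure μ] (hL : 0 < L) (hμ : MemLp id 2 μ)
    (hmean : ∫ x, x ∂μ = 0) : |∫ x in {x | |x| < L}, x ∂μ| ≤ replaceProb μ L * L := by
  have hi : Integrable (fun x : ℝ => x) μ := hμ.integrable one_le_two
  have hsum := setIntegral_abs_lt_add (L := L) (n := 1) (by simpa using hi)
  simp only [pow_one, hmean] at hsum
  have hle : ∫ x in {x | L ≤ |x|}, |x| ∂μ ≤ ∫ x in {x | L ≤ |x|}, L⁻¹ * x ^ 2 ∂μ := by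
    refine setIntegral_mono_on hi.abs.integrableOn (hμ.integrable_sq.const_mul _).integrableOn
      (compl_setOf_abs_lt L ▸ (measurableSet_abs_lt L).compl) fun x (hx : L ≤ |x|) => ?_
    rw [← sq_abs, le_inv_mul_iff₀ hL, sq]
    exact mul_le_mul_of_nonneg_right hx (abs_nonneg x)
  calc |∫ x in {x | |x| < L}, x ∂μ| = |∫ x in {x | L ≤ |x|}, x ∂μ| := by
        rw [eq_neg_of_add_eq_zero_left hsum, abs_neg]
    _ ≤ ∫ x in {x | L ≤ |x|}, |x| ∂μ := abs_integral_le_integral_abs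
    _ ≤ L⁻¹ * ∫ x in {x | L ≤ |x|}, x ^ 2 ∂μ := hle.trans_eq (integral_const_mul _ _)
    _ = replaceProb μ L * L := by rw [← replaceProb_mul_sq hL]; field_simp

theorem replaceBias_mul_replaceValue (hL : 0 < L) :
    replaceBias μ L * replaceValue μ L =
      -((1 - replaceProb μ L) * ∫ x in {x | |x| < L}, x ∂μ) :=
  div_mul_cancel₀ _ (hL.trans_le le_replaceValue).ne'

theorem abs_replaceBias_le [IsFiniteMeasure μ] (hL : 0 < L) (hμ : MemLp id 2 μ)
    (hmean : ∫ x, x ∂μ = 0) (hv : ∫ x, x ^ 2 ∂μ ≤ L ^ 2) :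
    |replaceBias μ L| ≤ replaceProb μ L := by
  have hq₀ : 0 ≤ replaceProb μ L := replaceProb_nonneg
  have hq₁ : 0 ≤ 1 - replaceProb μ L := sub_nonneg.mpr (replaceProb_le_one hμ.integrable_sq hv)
  have hLy : L ≤ replaceValue μ L := le_replaceValue
  have hy : 0 < replaceValue μ L := hL.trans_le hLy
  rw [replaceBias, abs_div, abs_neg, abs_mul, abs_of_nonneg hq₁, abs_of_pos hy, div_le_iff₀ hy]
  calc _ ≤ 1 * |∫ x in {x | |x| < L}, x ∂μ| :=
        mul_le_mul_of_nonneg_right (by linarith) (abs_nonneg _)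
    _ ≤ replaceProb μ L * L := (one_mul _).trans_le (abs_setIntegral_abs_lt_le hL hμ hmean)
    _ ≤ _ := mul_le_mul_of_nonneg_left hLy hq₀

theorem abs_truncate_le (hL : 0 ≤ L) (hi : Integrable (fun x => x ^ 2) μ)
    (hv : ∫ x, x ^ 2 ∂μ ≤ L ^ 2) (x : ℝ × Noise.{u}) : |truncate μ L x| ≤ 2 * L :=
  abs_replaceLarge_le hL (abs_replaceValue_le hL hi hv) x

variable [IsProbabilityMeasure μ] (hL : 0 < L) (hμ : MemLp id 2 μ) (hmean : ∫ x, x ∂μ = 0)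
  (hv : ∫ x, x ^ 2 ∂μ ≤ L ^ 2)

include hL hμ hmean hv

theorem isProbabilityMeasure_truncationNoise :
    IsProbabilityMeasure (truncationNoise.{u} μ L) :=
  Noise.isProbabilityMeasure_law (replaceProb_le_one hμ.integrable_sq hv)
    (abs_replaceBias_le hL hμ hmean hv)

theorem integral_truncate_pow {n : ℕ} (hn : n ≠ 0) :
    ∫ x, truncate μ L x ^ n ∂μ.prod (truncationNoise.{u} μ L) =
      (1 - replaceProb μ L) * ∫ x in {x | |x| < L}, x ^ n ∂μ +
        ((replaceProb μ L + replaceBias μ L) / 2 * replaceValue μ L ^ n +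
          (replaceProb μ L - replaceBias μ L) / 2 * (-replaceValue μ L) ^ n) :=
  integral_replaceLarge_pow hL.le (abs_replaceValue_le hL.le hμ.integrable_sq hv)
    (replaceProb_le_one hμ.integrable_sq hv) (abs_replaceBias_le hL hμ hmean hv) hn

theorem integral_truncate_pow_four_le (h : MemLp id 4 μ) :
    ∫ x, truncate μ L x ^ 4 ∂μ.prod (truncationNoise.{u} μ L) ≤ 4 * ∫ x, x ^ 4 ∂μ := by
  have hi := integrable_pow_four_of_memLp h
  have hsum := setIntegral_abs_lt_add (L := L) hi
  have htail := pow_mul_setIntegral_le measurable_id' hL.le even_two even_two hμ.integrable_sq hi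
  have hsmall : 0 ≤ ∫ x in {x | |x| < L}, x ^ 4 ∂μ := integral_nonneg fun x => by positivity
  have hq : 0 ≤ replaceProb μ L := replaceProb_nonneg
  have hreplace : replaceProb μ L * replaceValue μ L ^ 4 ≤
      4 * ∫ x in {x | L ≤ |x|}, x ^ 4 ∂μ := by
    calc replaceProb μ L * replaceValue μ L ^ 4
        = replaceProb μ L * (replaceValue μ L ^ 2) ^ 2 := by ring
      _ ≤ replaceProb μ L * (2 * L ^ 2) ^ 2 := mul_le_mul_of_nonneg_left
          (pow_le_pow_left₀ (sq_nonneg _) (replaceValue_sq_le hμ.integrable_sq hv) 2) hq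
      _ = 4 * (L ^ 2 * (replaceProb μ L * L ^ 2)) := by ring
      _ ≤ _ := by
        rw [replaceProb_mul_sq hL]
        exact mul_le_mul_of_nonneg_left htail zero_le_four
  rw [integral_truncate_pow hL hμ hmean hv four_ne_zero]
  nlinarith [mul_nonneg hq hsmall]

theorem preservesMoments_truncate :
    PreservesMoments μ (truncationNoise.{u} μ L) (truncate μ L) := by
  have := isProbabilityMeasure_truncationNoise.{u} hL hμ hmean hv
  have hmeas : Measurable (truncate.{u} μ L) := measurable_replaceLarge L _
  have hmemLp (p : ENNReal) : MemLp (truncate.{u} μ L) p (μ.prod (truncationNoise μ L)) :=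
    .of_bound hmeas.aestronglyMeasurable (2 * L)
      (ae_of_all _ (abs_truncate_le hL.le hμ.integrable_sq hv))
  refine ⟨hmeas, hmemLp 2, fun _ => hmemLp 4, ?_, ?_,
    integral_truncate_pow_four_le hL hμ hmean hv⟩
  · have h := integral_truncate_pow.{u} hL hμ hmean hv one_ne_zero
    simp only [pow_one] at h
    rw [h, hmean]
    linear_combination replaceBias_mul_replaceValue (μ := μ) hL
  · rw [integral_truncate_pow hL hμ hmean hv two_ne_zero, neg_sq, replaceValue_sq,
      ← setIntegral_abs_lt_add (L := L) hμ.integrable_sq, ← replaceProb_mul_sq hL]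
    ring

theorem measureReal_truncate_ne_le :
    (μ.prod (truncationNoise.{u} μ L)).real {x | truncate μ L x ≠ x.1} ≤
      2 * ((∫ x in {x | L ≤ |x|}, x ^ 2 ∂μ) / L ^ 2) := by
  have htail := pow_mul_setIntegral_le (n := 0) measurable_id' hL.le even_two (by decide)
    (integrable_const (1 : ℝ)) hμ.integrable_sq
  have hprob : μ.real {x | L ≤ |x|} ≤ replaceProb μ L := by
    rw [replaceProb, le_div_iff₀' (by positivity)]
    simpa using htail
  refine (measureReal_replaceLarge_ne_le (replaceProb_le_one hμ.integrable_sq hv)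
    (abs_replaceBias_le hL hμ hmean hv)).trans ?_
  rw [two_mul]
  exact add_le_add_left hprob _

end Truncation

section Enlargement

variable {Ω ι C : Type*} [MeasurableSpace Ω] [MeasurableSpace C] [Fintype ι]
  {P : Measure Ω} [IsProbabilityMeasure P] {X : ι → Ω → ℝ}
  {ν : ι → Measure C} [∀ p, IsProbabilityMeasure (ν p)]

theorem measurePreserving_prodMk_eval (hX : ∀ p, Measurable (X p)) (p : ι) :
    MeasurePreserving (fun ω : Ω × (ι → C) => (X p ω.1, ω.2 p)) (P.prod (Measure.pi ν))
      ((P.map (X p)).prod (ν p)) := by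
  have : IsProbabilityMeasure (P.map (X p)) := Measure.isProbabilityMeasure_map (hX p).aemeasurable
  exact ((hX p).measurePreserving P).prod (measurePreserving_eval ν p)

theorem iIndepFun_prodMk_eval (hX : ∀ p, Measurable (X p)) (hind : iIndepFun X P) :
    iIndepFun (fun p (ω : Ω × (ι → C)) => (X p ω.1, ω.2 p)) (P.prod (Measure.pi ν)) := by
  have (p : ι) : IsProbabilityMeasure (P.map (X p)) :=
    Measure.isProbabilityMeasure_map (hX p).aemeasurable
  rw [iIndepFun_iff_map_fun_eq_pi_map fun p =>
    (measurePreserving_prodMk_eval (P := P) (ν := ν) hX p).measurable.aemeasurable]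
  simp_rw [(measurePreserving_prodMk_eval hX _).map_eq]
  have hlaw : MeasurePreserving (fun ω p => X p ω) P (Measure.pi fun p => P.map (X p)) :=
    ⟨measurable_pi_lambda _ hX,
      (iIndepFun_iff_map_fun_eq_pi_map fun p => (hX p).aemeasurable).mp hind⟩
  exact ((measurePreserving_arrowProdEquivProdArrow ℝ C ι (fun p => P.map (X p)) ν).symm.comp
    (hlaw.prod (.id (Measure.pi ν)))).map_eq

end Enlargement

theorem apply_upperIndex {N : ℕ} {A : Matrix (Fin N) (Fin N) ℝ} (hA : A.IsSymm) (j k : Fin N) :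
    A (upperIndex j k).1.1 (upperIndex j k).1.2 = A j k :=
  congr_fun₂ (symMatrix_of_isSymm hA) j k

theorem upperIndex_fst_ne_snd {N : ℕ} {j k : Fin N} (h : j ≠ k) :
    (upperIndex j k).1.1 ≠ (upperIndex j k).1.2 := by
  rcases upperIndex_eq_iff.mp (Eq.refl (upperIndex j k)) with h' | h' <;> rw [h']
  exacts [h, h.symm]

/-- Apply to each entry on or above the diagonal of a symmetric matrix a function of the entry and
of its own source of randomness, and reflect the result at the diagonal. -/
def transformEntries {N : ℕ} {C : Type*} (τ : UpperIndex N → ℝ × C → ℝ)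
    (A : Matrix (Fin N) (Fin N) ℝ) (c : UpperIndex N → C) : Matrix (Fin N) (Fin N) ℝ :=
  symMatrix fun p => τ p (A p.1.1 p.1.2, c p)

namespace IsWigner

variable {Ω : ℕ → Type u} [∀ N, MeasurableSpace (Ω N)] {P : ∀ N, Measure (Ω N)}
  {W : ∀ N, Ω N → Matrix (Fin N) (Fin N) ℝ} {σ σ₁ m₄ : ℝ} {C : Type u} [MeasurableSpace C]

section SingleMatrix

variable {N : ℕ} {τ : UpperIndex N → ℝ × C → ℝ}

theorem measurable_transformEntries (hW : IsWigner P W σ σ₁ m₄) (hτ : ∀ p, Measurable (τ p))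
    (j k : Fin N) : Measurable fun ω : Ω N × (UpperIndex N → C) =>
      transformEntries τ (W N ω.1) ω.2 j k :=
  (hτ _).comp (((hW.measurable_entry N _ _).comp measurable_fst).prodMk
    ((measurable_pi_apply _).comp measurable_snd))

variable [∀ N, IsProbabilityMeasure (P N)] {ν : UpperIndex N → Measure C}
  [∀ p, IsProbabilityMeasure (ν p)]

theorem measurePreserving_entry_prodMk (hW : IsWigner P W σ σ₁ m₄) (p : UpperIndex N) :
    MeasurePreserving (fun ω : Ω N × (UpperIndex N → C) => (W N ω.1 p.1.1 p.1.2, ω.2 p))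
      ((P N).prod (Measure.pi ν)) ((entryLaw (P N) (W N) p).prod (ν p)) :=
  measurePreserving_prodMk_eval (X := fun p ω => W N ω p.1.1 p.1.2)
    (fun p => hW.measurable_entry N p.1.1 p.1.2) p

theorem integral_transformEntries (hW : IsWigner P W σ σ₁ m₄) (hτ : ∀ p, Measurable (τ p))
    {f : ℝ → ℝ} (hf : Measurable f) (j k : Fin N) :
    ∫ ω, f (transformEntries τ (W N ω.1) ω.2 j k) ∂(P N).prod (Measure.pi ν) =
      ∫ x, f (τ (upperIndex j k) x)
        ∂(entryLaw (P N) (W N) (upperIndex j k)).prod (ν (upperIndex j k)) := by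
  have hmp := hW.measurePreserving_entry_prodMk (ν := ν) (upperIndex j k)
  rw [← hmp.map_eq]
  exact (integral_map hmp.measurable.aemeasurable (hf.comp (hτ _)).aestronglyMeasurable).symm

theorem integral_transformEntries_eq_zero (hW : IsWigner P W σ σ₁ m₄)
    (hτ : ∀ p, PreservesMoments (entryLaw (P N) (W N) p) (ν p) (τ p)) (j k : Fin N) :
    ∫ ω, transformEntries τ (W N ω.1) ω.2 j k ∂(P N).prod (Measure.pi ν) = 0 := by
  rw [hW.integral_transformEntries (fun p => (hτ p).measurable) measurable_id',
    (hτ _).integral_eq, hW.integral_entryLaw_eq_zero]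

theorem integral_sq_transformEntries (hW : IsWigner P W σ σ₁ m₄)
    (hτ : ∀ p, PreservesMoments (entryLaw (P N) (W N) p) (ν p) (τ p)) (j k : Fin N) :
    ∫ ω, transformEntries τ (W N ω.1) ω.2 j k ^ 2 ∂(P N).prod (Measure.pi ν) =
      ∫ ω, W N ω j k ^ 2 ∂(P N) := by
  rw [hW.integral_transformEntries (fun p => (hτ p).measurable) (measurable_id'.pow_const 2),
    (hτ _).integral_sq_eq, hW.integral_entryLaw (measurable_id'.pow_const 2)]
  simp only [apply_upperIndex (hW.isSymm N _)]

theorem iIndepFun_transformEntries (hW : IsWigner P W σ σ₁ m₄) (hτ : ∀ p, Measurable (τ p)) :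
    iIndepFun (fun (p : UpperIndex N) (ω : Ω N × (UpperIndex N → C)) =>
      transformEntries τ (W N ω.1) ω.2 p.1.1 p.1.2) ((P N).prod (Measure.pi ν)) := by
  have h := (iIndepFun_prodMk_eval (ν := ν) (fun p => hW.measurable_entry N p.1.1 p.1.2)
    (hW.indep N)).comp τ hτ
  convert h using 2 with p
  ext ω
  simp only [transformEntries, symMatrix, Matrix.of_apply, upperIndex_of_le p.2]
  rfl

end SingleMatrix

theorem isWigner_transformEntries [∀ N, IsProbabilityMeasure (P N)]
    {ν : ∀ N, UpperIndex N → Measure C} [∀ N p, IsProbabilityMeasure (ν N p)]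
    {τ : ∀ N, UpperIndex N → ℝ × C → ℝ} (hW : IsWigner P W σ σ₁ m₄)
    (hτ : ∀ N p, PreservesMoments (entryLaw (P N) (W N) p) (ν N p) (τ N p)) :
    IsWigner (Ω := fun N => Ω N × (UpperIndex N → C)) (fun N => (P N).prod (Measure.pi (ν N)))
      (fun N ω => transformEntries (τ N) (W N ω.1) ω.2) σ σ₁ (4 * m₄) := by
  have hmeas (N : ℕ) (p : UpperIndex N) : Measurable (τ N p) := (hτ N p).measurable
  have hmean (N : ℕ) := hW.integral_transformEntries_eq_zero (hτ N)
  refine ⟨fun N => hW.measurable_transformEntries (hmeas N), fun N ω => isSymm_symMatrix _,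
    fun N => hW.iIndepFun_transformEntries (hmeas N), fun N j k hjk => ?_,
    fun N j k _ => hmean N j k, fun N j k hjk => ?_, fun N j k hjk => ?_, fun N j => ?_,
    fun N j => hmean N j j,
    fun N j => (hW.integral_sq_transformEntries (hτ N) j j).trans_le (hW.diag_second N j)⟩
  · exact ((hτ N _).memLp_four (hW.memLp_four_entryLaw
      (upperIndex_fst_ne_snd hjk))).comp_measurePreserving (hW.measurePreserving_entry_prodMk _)
  · rw [variance_of_integral_eq_zero
      (hW.measurable_transformEntries (hmeas N) j k).aemeasurable (hmean N j k),
      hW.integral_sq_transformEntries (hτ N), hW.integral_offDiag_sq N hjk]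
  · have hp := upperIndex_fst_ne_snd hjk
    rw [hW.integral_transformEntries (hmeas N) (measurable_id'.pow_const 4)]
    exact ((hτ N _).integral_pow_four_le (hW.memLp_four_entryLaw hp)).trans
      (mul_le_mul_of_nonneg_left (hW.integral_pow_four_entryLaw_le hp) zero_le_four)
  · exact (hτ N _).memLp_two.comp_measurePreserving (hW.measurePreserving_entry_prodMk _)

end IsWigner

/-- The transformation of the entry in position `p` when the entries of the first `m` rows and
columns, with laws `μ`, are truncated at level `L`. -/
noncomputable def rowTransform {N : ℕ} (μ : UpperIndex N → Measure ℝ) (m : ℕ) (L : ℝ)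
    (p : UpperIndex N) : ℝ × Noise.{u} → ℝ :=
  if (p.1.1 : ℕ) < m then truncate (μ p) L else Prod.fst

/-- The law on the enlarged probability space on which the entries of `A` are truncated at
level `L`, each one with its own independent `Noise`. -/
noncomputable def enlargedMeasure {Ω : Type*} [MeasurableSpace Ω] {N : ℕ} (P : Measure Ω)
    (A : Ω → Matrix (Fin N) (Fin N) ℝ) (L : ℝ) : Measure (Ω × (UpperIndex N → Noise.{u})) :=
  P.prod (Measure.pi fun p => truncationNoise (entryLaw P A p) L)

/-- The random matrix obtained from `A` by truncating the first `m` rows and columns at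
level `L`. -/
noncomputable def truncateRows {Ω : Type*} [MeasurableSpace Ω] {N : ℕ} (P : Measure Ω)
    (A : Ω → Matrix (Fin N) (Fin N) ℝ) (m : ℕ) (L : ℝ) (ω : Ω × (UpperIndex N → Noise.{u})) :
    Matrix (Fin N) (Fin N) ℝ :=
  transformEntries (rowTransform (entryLaw P A) m L) (A ω.1) ω.2

section SingleMatrix

variable {Ω : Type*} [MeasurableSpace Ω] {N : ℕ} {P : Measure Ω}
  {A : Ω → Matrix (Fin N) (Fin N) ℝ} {m : ℕ} {L : ℝ}

theorem truncateRows_apply_of_ge {ω : Ω × (UpperIndex N → Noise.{u})} (hA : (A ω.1).IsSymm)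
    {j k : Fin N} (hj : m ≤ j) (hk : m ≤ k) : truncateRows P A m L ω j k = A ω.1 j k := by
  have hp : ¬ ((upperIndex j k).1.1 : ℕ) < m := by
    rcases upperIndex_eq_iff.mp (Eq.refl (upperIndex j k)) with h | h <;> rw [h] <;> simpa
  rw [← apply_upperIndex hA]
  simp only [truncateRows, transformEntries, symMatrix, Matrix.of_apply, rowTransform, hp, if_false]

theorem upperIndex_fst_lt {j k : Fin N} (hj : (j : ℕ) < m) : ((upperIndex j k).1.1 : ℕ) < m :=
  lt_of_le_of_lt (min_le_left j k : (upperIndex j k).1.1 ≤ j) hj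

end SingleMatrix

namespace IsWigner

variable {Ω : ℕ → Type u} [∀ N, MeasurableSpace (Ω N)] {P : ∀ N, Measure (Ω N)}
  [∀ N, IsProbabilityMeasure (P N)] {W : ∀ N, Ω N → Matrix (Fin N) (Fin N) ℝ} {σ σ₁ m₄ : ℝ}

section Level

variable {N : ℕ} {L : ℝ}

theorem isProbabilityMeasure_truncationNoise (hW : IsWigner P W σ σ₁ m₄) (hL : 0 < L)
    (hs : σ ^ 2 + σ₁ ^ 2 ≤ L ^ 2) (p : UpperIndex N) :
    IsProbabilityMeasure (truncationNoise.{u} (entryLaw (P N) (W N) p) L) := by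
  have := hW.isProbabilityMeasure_entryLaw N p
  exact WignerResolvent.isProbabilityMeasure_truncationNoise hL (hW.memLp_two_entryLaw N p)
    (hW.integral_entryLaw_eq_zero N p) ((hW.integral_sq_entryLaw_le N p).trans hs)

theorem measurePreserving_fst_enlargedMeasure (hW : IsWigner P W σ σ₁ m₄) (hL : 0 < N → 0 < L)
    (hs : 0 < N → σ ^ 2 + σ₁ ^ 2 ≤ L ^ 2) :
    MeasurePreserving Prod.fst (enlargedMeasure.{u} (P N) (W N) L) (P N) := by
  have (p : UpperIndex N) :=
    hW.isProbabilityMeasure_truncationNoise (hL p.1.1.pos) (hs p.1.1.pos) p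
  exact measurePreserving_fst

theorem isProbabilityMeasure_enlargedMeasure (hW : IsWigner P W σ σ₁ m₄) (hL : 0 < N → 0 < L)
    (hs : 0 < N → σ ^ 2 + σ₁ ^ 2 ≤ L ^ 2) :
    IsProbabilityMeasure (enlargedMeasure.{u} (P N) (W N) L) := by
  have : IsProbabilityMeasure ((enlargedMeasure.{u} (P N) (W N) L).map Prod.fst) := by
    rw [(hW.measurePreserving_fst_enlargedMeasure hL hs).map_eq]
    infer_instance
  exact Measure.isProbabilityMeasure_of_map Prod.fst

theorem preservesMoments_rowTransform (hW : IsWigner P W σ σ₁ m₄) (hL : 0 < L)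
    (hs : σ ^ 2 + σ₁ ^ 2 ≤ L ^ 2) (m : ℕ) (p : UpperIndex N) :
    PreservesMoments (entryLaw (P N) (W N) p) (truncationNoise.{u} (entryLaw (P N) (W N) p) L)
      (rowTransform (entryLaw (P N) (W N)) m L p) := by
  have := hW.isProbabilityMeasure_entryLaw N p
  have := hW.isProbabilityMeasure_truncationNoise hL hs p
  unfold rowTransform
  split_ifs
  · exact preservesMoments_truncate hL (hW.memLp_two_entryLaw N p)
      (hW.integral_entryLaw_eq_zero N p) ((hW.integral_sq_entryLaw_le N p).trans hs)
  · exact preservesMoments_fst (hW.memLp_two_entryLaw N p)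

theorem abs_truncateRows_le (hW : IsWigner P W σ σ₁ m₄) (hL : 0 < L)
    (hs : σ ^ 2 + σ₁ ^ 2 ≤ L ^ 2) {m : ℕ} (ω : Ω N × (UpperIndex N → Noise.{u})) {j k : Fin N}
    (hj : (j : ℕ) < m) : |truncateRows (P N) (W N) m L ω j k| ≤ 2 * L := by
  simp only [truncateRows, transformEntries, symMatrix, Matrix.of_apply, rowTransform,
    upperIndex_fst_lt hj, if_true]
  exact abs_truncate_le hL.le (hW.memLp_two_entryLaw N _).integrable_sq
    ((hW.integral_sq_entryLaw_le N _).trans hs) _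

theorem measureReal_rowTransform_ne_le (hW : IsWigner P W σ σ₁ m₄) (hL : 0 < L)
    (hs : σ ^ 2 + σ₁ ^ 2 ≤ L ^ 2) {m : ℕ} (p : UpperIndex N) :
    (enlargedMeasure.{u} (P N) (W N) L).real {ω |
        rowTransform (entryLaw (P N) (W N)) m L p (W N ω.1 p.1.1 p.1.2, ω.2 p) ≠
          W N ω.1 p.1.1 p.1.2} ≤
      if (p.1.1 : ℕ) < m then
        2 * ((∫ ω in {ω | L ≤ |W N ω p.1.1 p.1.2|}, W N ω p.1.1 p.1.2 ^ 2 ∂(P N)) / L ^ 2)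
      else 0 := by
  have := hW.isProbabilityMeasure_entryLaw N p
  have := hW.isProbabilityMeasure_truncationNoise (N := N) hL hs
  have hmp := hW.measurePreserving_entry_prodMk
    (ν := fun p => truncationNoise.{u} (entryLaw (P N) (W N) p) L) p
  have hset : MeasurableSet {x | rowTransform.{u} (entryLaw (P N) (W N)) m L p x ≠ x.1} :=
    (measurableSet_eq_fun (hW.preservesMoments_rowTransform hL hs m p).measurable
      measurable_fst).compl
  have htail : ∫ x in {x | L ≤ |x|}, x ^ 2 ∂entryLaw (P N) (W N) p =
      ∫ ω in {ω | L ≤ |W N ω p.1.1 p.1.2|}, W N ω p.1.1 p.1.2 ^ 2 ∂(P N) :=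
    setIntegral_map (measurableSet_le measurable_const measurable_id.abs)
      (measurable_id.pow_const 2).aestronglyMeasurable (hW.measurable_entry N _ _).aemeasurable
  refine (hmp.measureReal_preimage hset.nullMeasurableSet).trans_le ?_
  unfold rowTransform
  split_ifs
  · rw [← htail]
    exact measureReal_truncate_ne_le hL (hW.memLp_two_entryLaw N p)
      (hW.integral_entryLaw_eq_zero N p) ((hW.integral_sq_entryLaw_le N p).trans hs)
  · simp

end Level

theorem isWigner_truncateRows (hW : IsWigner P W σ σ₁ m₄) {L : ℕ → ℝ}
    (hL : ∀ N, 0 < N → 0 < L N) (hs : ∀ N, 0 < N → σ ^ 2 + σ₁ ^ 2 ≤ L N ^ 2) (m : ℕ) :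
    IsWigner (fun N => enlargedMeasure.{u} (P N) (W N) (L N))
      (fun N => truncateRows (P N) (W N) m (L N)) σ σ₁ (4 * m₄) := by
  have (N : ℕ) (p : UpperIndex N) :
      IsProbabilityMeasure (truncationNoise.{u} (entryLaw (P N) (W N) p) (L N)) :=
    hW.isProbabilityMeasure_truncationNoise (hL N p.1.1.pos) (hs N p.1.1.pos) p
  exact hW.isWigner_transformEntries fun N p =>
    hW.preservesMoments_rowTransform (hL N p.1.1.pos) (hs N p.1.1.pos) m p

end IsWigner

section RowProbability

variable {Ω : ℕ → Type u} [∀ N, MeasurableSpace (Ω N)] {P : ∀ N, Measure (Ω N)}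
  {W : ∀ N, Ω N → Matrix (Fin N) (Fin N) ℝ} {σ σ₁ m₄ : ℝ} {N m : ℕ} {ε L : ℝ}

theorem rowLindeberg_apply (k : Fin N) :
    rowLindeberg P W k ε N = (∑ l ∈ Finset.univ.erase k,
      ∫ ω in {ω | ε * (N : ℝ) ^ (1 / 4 : ℝ) ≤ |W N ω k l|}, W N ω k l ^ 4 ∂(P N)) / N := by
  simp only [rowLindeberg, k.2, dif_pos, Fin.eta, Even.pow_abs (by decide : Even 4),
    one_div_mul_eq_div]

theorem rowLindeberg_nonneg (i : ℕ) : 0 ≤ rowLindeberg P W i ε N := by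
  rw [rowLindeberg]
  split_ifs
  · exact mul_nonneg (by positivity)
      (Finset.sum_nonneg fun _ _ => integral_nonneg fun _ => by positivity)
  · exact le_rfl

theorem IsWigner.setOf_truncateRows_eq_compl_subset (hW : IsWigner P W σ σ₁ m₄) :
    {ω : Ω N × (UpperIndex N → Noise.{u}) | ∀ i k : Fin N, (i : ℕ) < m →
        truncateRows (P N) (W N) m L ω i k = W N ω.1 i k}ᶜ ⊆
      ⋃ p : UpperIndex N, {ω | rowTransform (entryLaw (P N) (W N)) m L p
        (W N ω.1 p.1.1 p.1.2, ω.2 p) ≠ W N ω.1 p.1.1 p.1.2} := by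
  intro ω hω
  simp only [Set.mem_compl_iff, Set.mem_ofPred_eq, not_forall] at hω
  obtain ⟨i, k, _, hne⟩ := hω
  refine Set.mem_iUnion.mpr ⟨upperIndex i k, fun h => hne ?_⟩
  exact h.trans (apply_upperIndex (hW.isSymm N ω.1) i k)

variable [∀ N, IsProbabilityMeasure (P N)]

theorem IsWigner.sum_setIntegral_sq_div_le (hW : IsWigner P W σ σ₁ m₄) (hε : 0 < ε)
    (hL : L = ε * (N : ℝ) ^ (1 / 4 : ℝ)) (k : Fin N) :
    ∑ l, (∫ ω in {ω | L ≤ |W N ω k l|}, W N ω k l ^ 2 ∂(P N)) / L ^ 2 ≤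
      σ₁ ^ 2 / L ^ 2 + rowLindeberg P W k ε N / ε ^ 4 := by
  have hN : (0 : ℝ) < N := Nat.cast_pos.mpr k.pos
  have hL0 : 0 < L := by rw [hL]; positivity
  have hL4 : L ^ 4 = N * ε ^ 4 := by
    rw [hL, mul_pow, mul_comm, ← Real.rpow_mul_natCast hN.le]
    norm_num
  have hdiag : ∫ ω in {ω | L ≤ |W N ω k k|}, W N ω k k ^ 2 ∂(P N) ≤ σ₁ ^ 2 :=
    (setIntegral_le_integral (hW.memLp_two N k k).integrable_sq
      (ae_of_all _ fun _ => sq_nonneg _)).trans (hW.diag_second N k)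
  have hoff (l : Fin N) (hl : l ∈ Finset.univ.erase k) :
      (∫ ω in {ω | L ≤ |W N ω k l|}, W N ω k l ^ 2 ∂(P N)) / L ^ 2 ≤
        (∫ ω in {ω | L ≤ |W N ω k l|}, W N ω k l ^ 4 ∂(P N)) / L ^ 4 := by
    have hi : Integrable (fun ω => W N ω k l ^ 4) (P N) := by
      simpa [Real.norm_eq_abs, Even.pow_abs (by decide : Even 4)] using
        (hW.offDiag_memLp N k l (Finset.ne_of_mem_erase hl).symm).integrable_norm_pow four_ne_zero
    have h := pow_mul_setIntegral_le (hW.measurable_entry N k l) hL0.le even_two even_two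
      (hW.memLp_two N k l).integrable_sq hi
    rw [div_le_div_iff₀ (by positivity) (by positivity)]
    calc _ = (L ^ 2 * ∫ ω in {ω | L ≤ |W N ω k l|}, W N ω k l ^ 2 ∂(P N)) * L ^ 2 := by ring
      _ ≤ _ := mul_le_mul_of_nonneg_right h (sq_nonneg L)
  rw [← Finset.add_sum_erase _ _ (Finset.mem_univ k), rowLindeberg_apply, ← hL, div_div, ← hL4,
    Finset.sum_div]
  exact add_le_add (div_le_div_of_nonneg_right hdiag (sq_nonneg L)) (Finset.sum_le_sum hoff)

theorem IsWigner.measureReal_truncateRows_ne_le (hW : IsWigner P W σ σ₁ m₄) (hε : 0 < ε)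
    (hN : 0 < N) (hL : L = ε * (N : ℝ) ^ (1 / 4 : ℝ)) (hs : σ ^ 2 + σ₁ ^ 2 ≤ L ^ 2) :
    (enlargedMeasure.{u} (P N) (W N) L).real {ω | ∀ i k : Fin N, (i : ℕ) < m →
        truncateRows (P N) (W N) m L ω i k = W N ω.1 i k}ᶜ ≤
      ∑ i ∈ Finset.range m, 2 * (σ₁ ^ 2 / L ^ 2 + rowLindeberg P W i ε N / ε ^ 4) := by
  have hL0 : 0 < L := by rw [hL]; positivity
  have := hW.isProbabilityMeasure_enlargedMeasure (N := N) (fun _ => hL0) fun _ => hs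
  set B : Fin N × Fin N → ℝ := fun q => if (q.1 : ℕ) < m then
    2 * ((∫ ω in {ω | L ≤ |W N ω q.1 q.2|}, W N ω q.1 q.2 ^ 2 ∂(P N)) / L ^ 2) else 0 with hB
  set F : ℕ → ℝ := fun i => 2 * (σ₁ ^ 2 / L ^ 2 + rowLindeberg P W i ε N / ε ^ 4)
  have hB_nonneg (q : Fin N × Fin N) : 0 ≤ B q := by
    have : 0 ≤ ∫ ω in {ω | L ≤ |W N ω q.1 q.2|}, W N ω q.1 q.2 ^ 2 ∂(P N) :=
      integral_nonneg fun _ => sq_nonneg _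
    simp only [hB]
    split_ifs <;> positivity
  have hF_nonneg (i : ℕ) : 0 ≤ F i := by
    have := rowLindeberg_nonneg (P := P) (W := W) (ε := ε) (N := N) i
    positivity
  have hrow (k : Fin N) : ∑ l, B (k, l) ≤ if (k : ℕ) < m then F k else 0 := by
    split_ifs with hk
    · simp only [hB, hk, if_true, ← Finset.mul_sum]
      exact mul_le_mul_of_nonneg_left (hW.sum_setIntegral_sq_div_le hε hL k) zero_le_two
    · simp only [hB, hk, if_false, Finset.sum_const_zero, le_refl]
  calc _ ≤ ∑ p : UpperIndex N, B p.1 :=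
        (measureReal_mono hW.setOf_truncateRows_eq_compl_subset).trans
          ((measureReal_iUnion_fintype_le _).trans
            (Finset.sum_le_sum fun p _ => hW.measureReal_rowTransform_ne_le hL0 hs p))
    _ ≤ ∑ q, B q := sum_upperIndex_le hB_nonneg
    _ = ∑ k, ∑ l, B (k, l) := Fintype.sum_prod_type B
    _ ≤ ∑ k : Fin N, if (k : ℕ) < m then F k else 0 := Finset.sum_le_sum fun k _ => hrow k
    _ = ∑ i ∈ Finset.range N with i < m, F i := by
        rw [Fin.sum_univ_eq_sum_range (fun i => if i < m then F i else 0), Finset.sum_filter]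
    _ ≤ ∑ i ∈ Finset.range m, F i :=
        Finset.sum_le_sum_of_subset_of_nonneg
          (fun i hi => Finset.mem_range.mpr (Finset.mem_filter.mp hi).2) fun i _ _ => hF_nonneg i

end RowProbability

theorem exists_tendsto_atTop_eventually {p : ℕ → ℕ → Prop} (h : ∀ k, ∀ᶠ n in atTop, p k n) :
    ∃ κ : ℕ → ℕ, Tendsto κ atTop atTop ∧ ∀ᶠ n in atTop, p (κ n) n := by
  classical
  simp_rw [eventually_atTop] at h
  choose n₀ hn₀ using h
  refine ⟨fun n => Nat.findGreatest (fun k => n₀ k ≤ n) n, tendsto_atTop.mpr fun k => ?_, ?_⟩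
  · filter_upwards [eventually_ge_atTop (max k (n₀ k))] with n hn
    exact Nat.le_findGreatest ((le_max_left _ _).trans hn) ((le_max_right _ _).trans hn)
  · filter_upwards [eventually_ge_atTop (n₀ 0)] with n hn
    exact hn₀ _ _ (Nat.findGreatest_spec (P := fun k => n₀ k ≤ n) (Nat.zero_le n) hn)

section TruncationLevels

variable {ι : Type*} {s : Finset ι} {f : ι → ℝ → ℕ → ℝ}

theorem exists_slow_levels (hf₀ : ∀ i ε N, 0 ≤ f i ε N)
    (hf : ∀ i ∈ s, ∀ δ > 0, Tendsto (f i δ) atTop (𝓝 0)) :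
    ∃ ε : ℕ → ℝ, (∀ N, 0 < ε N) ∧ Tendsto ε atTop (𝓝 0) ∧
      Tendsto (fun N : ℕ => ε N * (N : ℝ) ^ (1 / 4 : ℝ)) atTop atTop ∧
      ∀ i ∈ s, Tendsto (fun N => f i (ε N) N / ε N ^ 4) atTop (𝓝 0) := by
  set e : ℕ → ℝ := fun k => 1 / ((k : ℝ) + 1)
  have he₀ (k : ℕ) : 0 < e k := by positivity
  have he : Tendsto e atTop (𝓝 0) := tendsto_one_div_add_atTop_nhds_zero_nat
  have hpow : Tendsto (fun N : ℕ => (N : ℝ) ^ (1 / 4 : ℝ)) atTop atTop :=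
    (tendsto_rpow_atTop (by norm_num)).comp tendsto_natCast_atTop_atTop
  have hfixed (k : ℕ) : ∀ᶠ N : ℕ in atTop, (k : ℝ) ≤ e k * (N : ℝ) ^ (1 / 4 : ℝ) ∧
      ∀ i ∈ s, f i (e k) N < e k ^ 5 := by
    refine ((hpow.const_mul_atTop (he₀ k)).eventually_ge_atTop (k : ℝ)).and ?_
    rw [eventually_all_finset]
    exact fun i hi => (hf i hi (e k) (he₀ k)).eventually_lt_const (pow_pos (he₀ k) 5)
  obtain ⟨κ, hκ, hslow⟩ := exists_tendsto_atTop_eventually hfixed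
  refine ⟨fun N => e (κ N), fun N => he₀ _, he.comp hκ,
    tendsto_atTop_mono' _ (hslow.mono fun N h => h.1) (tendsto_natCast_atTop_atTop.comp hκ),
    fun i hi => squeeze_zero' (Eventually.of_forall fun N =>
      div_nonneg (hf₀ _ _ _) (pow_pos (he₀ _) 4).le) (hslow.mono fun N h => ?_) (he.comp hκ)⟩
  rw [div_le_iff₀ (pow_pos (he₀ _) 4)]
  exact (h.2 i hi).le.trans_eq (pow_succ' _ 4)

theorem exists_truncation_levels (c : ℝ) (hf₀ : ∀ i ε N, 0 ≤ f i ε N)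
    (hf : ∀ i ∈ s, ∀ δ > 0, Tendsto (f i δ) atTop (𝓝 0)) :
    ∃ ε : ℕ → ℝ, (∀ N, 0 < ε N) ∧ Tendsto ε atTop (𝓝 0) ∧
      Tendsto (fun N : ℕ => ε N * (N : ℝ) ^ (1 / 4 : ℝ)) atTop atTop ∧
      (∀ N : ℕ, 0 < N → c ≤ ε N * (N : ℝ) ^ (1 / 4 : ℝ)) ∧
      ∀ i ∈ s, Tendsto (fun N => f i (ε N) N / ε N ^ 4) atTop (𝓝 0) := by
  obtain ⟨ε, hε₀, hε, hεN, hfε⟩ := exists_slow_levels hf₀ hf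
  have hmax : ∀ᶠ N : ℕ in atTop, ε N = max (ε N) (c / (N : ℝ) ^ (1 / 4 : ℝ)) := by
    filter_upwards [hεN.eventually_ge_atTop c, eventually_gt_atTop 0] with N h hN
    exact (max_eq_left ((div_le_iff₀ (by positivity)).mpr h)).symm
  refine ⟨fun N => max (ε N) (c / (N : ℝ) ^ (1 / 4 : ℝ)), fun N => lt_max_of_lt_left (hε₀ N),
    hε.congr' hmax, tendsto_atTop_mono (fun N => ?_) hεN, fun N hN => ?_, fun i hi => ?_⟩
  · exact mul_le_mul_of_nonneg_right (le_max_left _ _) (by positivity)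
  · rw [← div_le_iff₀ (by positivity)]
    exact le_max_right _ _
  · exact (hfε i hi).congr' (hmax.mono fun N h => by simp only [← h])

end TruncationLevels

theorem tendsto_measure_one_of_measureReal_compl_le {Ω : ℕ → Type*} [∀ N, MeasurableSpace (Ω N)]
    {P : ∀ N, Measure (Ω N)} [∀ N, IsProbabilityMeasure (P N)] {S : ∀ N, Set (Ω N)} {b : ℕ → ℝ}
    (hb : Tendsto b atTop (𝓝 0)) (hS : ∀ᶠ N in atTop, (P N).real (S N)ᶜ ≤ b N) :
    Tendsto (fun N => P N (S N)) atTop (𝓝 1) := by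
  have hlow : Tendsto (fun N => ENNReal.ofReal (1 - b N)) atTop (𝓝 1) := by
    simpa using ENNReal.tendsto_ofReal (hb.const_sub 1)
  refine tendsto_of_tendsto_of_tendsto_of_le_of_le' hlow tendsto_const_nhds
    (hS.mono fun N h => ENNReal.ofReal_le_of_le_toReal ?_)
    (Eventually.of_forall fun N => prob_le_one)
  have hunion := measureReal_union_le (μ := P N) (S N) (S N)ᶜ
  rw [Set.union_compl_self, probReal_univ] at hunion
  exact (sub_le_sub_left h 1).trans (sub_le_iff_le_add.mpr hunion)

section RowTruncation

variable {Ω : ℕ → Type u} [∀ N, MeasurableSpace (Ω N)] {P : ∀ N, Measure (Ω N)}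
  [∀ N, IsProbabilityMeasure (P N)] {W : ∀ N, Ω N → Matrix (Fin N) (Fin N) ℝ} {σ σ₁ m₄ : ℝ}
  {m : ℕ}

theorem IsWigner.tendsto_measure_truncateRows_eq (hW : IsWigner P W σ σ₁ m₄) {ε L : ℕ → ℝ}
    (hε : ∀ N, 0 < ε N) (hLε : ∀ N, L N = ε N * (N : ℝ) ^ (1 / 4 : ℝ))
    (hL : Tendsto L atTop atTop) (hs : ∀ N, 0 < N → σ ^ 2 + σ₁ ^ 2 ≤ L N ^ 2)
    (hLin : ∀ i ∈ Finset.range m,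
      Tendsto (fun N => rowLindeberg P W i (ε N) N / ε N ^ 4) atTop (𝓝 0)) :
    Tendsto (fun N => enlargedMeasure.{u} (P N) (W N) (L N) {ω | ∀ i k : Fin N, (i : ℕ) < m →
      truncateRows (P N) (W N) m (L N) ω i k = W N ω.1 i k}) atTop (𝓝 1) := by
  have (N : ℕ) : IsProbabilityMeasure (enlargedMeasure.{u} (P N) (W N) (L N)) :=
    hW.isProbabilityMeasure_enlargedMeasure
      (fun hN => by rw [hLε]; have := hε N; positivity) (hs N)
  have hdiag : Tendsto (fun N => σ₁ ^ 2 / L N ^ 2) atTop (𝓝 0) :=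
    ((tendsto_pow_atTop two_ne_zero).comp hL).const_div_atTop _
  have hbound : Tendsto (fun N => ∑ i ∈ Finset.range m,
      2 * (σ₁ ^ 2 / L N ^ 2 + rowLindeberg P W i (ε N) N / ε N ^ 4)) atTop (𝓝 0) := by
    simpa using tendsto_finsetSum _ fun i hi => (hdiag.add (hLin i hi)).const_mul 2
  refine tendsto_measure_one_of_measureReal_compl_le hbound ?_
  filter_upwards [eventually_gt_atTop 0] with N hN
  exact hW.measureReal_truncateRows_ne_le (hε N) hN (hLε N) (hs N hN)

theorem IsWigner.isRowTruncation_truncateRows (hW : IsWigner P W σ σ₁ m₄) {ε L : ℕ → ℝ}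
    (hε : ∀ N, 0 < ε N) (hε₀ : Tendsto ε atTop (𝓝 0))
    (hLε : ∀ N, L N = ε N * (N : ℝ) ^ (1 / 4 : ℝ))
    (hL : Tendsto L atTop atTop) (hs : ∀ N, 0 < N → σ ^ 2 + σ₁ ^ 2 ≤ L N ^ 2)
    (hLin : ∀ i ∈ Finset.range m,
      Tendsto (fun N => rowLindeberg P W i (ε N) N / ε N ^ 4) atTop (𝓝 0)) :
    IsRowTruncation (fun N => enlargedMeasure.{u} (P N) (W N) (L N)) (fun N ω => W N ω.1)
      (fun N => truncateRows (P N) (W N) m (L N)) σ m fun N => 2 * ε N := by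
  have hL₀ (N : ℕ) (hN : 0 < N) : 0 < L N := by rw [hLε]; have := hε N; positivity
  have hT := hW.isWigner_truncateRows hL₀ hs m
  refine ⟨⟨σ₁, 4 * m₄, hT⟩, fun N => mul_pos two_pos (hε N), by simpa using hε₀.const_mul 2,
    fun N ω j k => truncateRows_apply_of_ge (hW.isSymm N ω.1),
    hW.tendsto_measure_truncateRows_eq hε hLε hL hs hLin,
    fun N i k _ => hT.integral_eq_zero N i k, fun N i k _ => hT.offDiag_variance N i k,
    ⟨σ₁ ^ 2, fun N i _ => ?_⟩, ⟨4 * m₄, fun N i k _ => hT.offDiag_fourth N i k⟩,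
    fun N ω i k hi => ?_⟩
  · rw [variance_of_integral_eq_zero (hT.measurable_entry N i i).aemeasurable (hT.diag_mean N i)]
    exact hT.diag_second N i
  · rw [mul_assoc, ← hLε]
    exact hW.abs_truncateRows_le (hL₀ N i.pos) (hs N i.pos) ω hi

theorem IsWigner.exists_isRowTruncation (hW : IsWigner P W σ σ₁ m₄)
    (hLin : ∀ i < m, ∀ δ > 0, Tendsto (rowLindeberg P W i δ) atTop (𝓝 0)) :
    ∃ (Ω' : ℕ → Type u) (_ : ∀ N, MeasurableSpace (Ω' N)) (P' : ∀ N, Measure (Ω' N))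
      (π : ∀ N, Ω' N → Ω N) (T : ∀ N, Ω' N → Matrix (Fin N) (Fin N) ℝ) (ε : ℕ → ℝ),
      (∀ N, IsProbabilityMeasure (P' N)) ∧ (∀ N, MeasurePreserving (π N) (P' N) (P N)) ∧
      IsWigner P' T σ σ₁ (4 * m₄) ∧
      IsRowTruncation P' (fun N ω => W N (π N ω)) T σ m ε := by
  obtain ⟨ε, hε, hε₀, hL, hmin, hLinε⟩ := exists_truncation_levels (s := Finset.range m)
    (|σ| + |σ₁| + 1) (fun i ε N => rowLindeberg_nonneg (P := P) (W := W) (ε := ε) (N := N) i)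
    fun i hi => hLin i (Finset.mem_range.mp hi)
  set L : ℕ → ℝ := fun N => ε N * (N : ℝ) ^ (1 / 4 : ℝ)
  have hc : 0 < |σ| + |σ₁| + 1 := by positivity
  have hs (N : ℕ) (hN : 0 < N) : σ ^ 2 + σ₁ ^ 2 ≤ L N ^ 2 := by
    refine le_trans ?_ (pow_le_pow_left₀ hc.le (hmin N hN) 2)
    rw [← sq_abs σ, ← sq_abs σ₁]
    nlinarith [abs_nonneg σ, abs_nonneg σ₁, mul_nonneg (abs_nonneg σ) (abs_nonneg σ₁)]
  have hL₀ (N : ℕ) (hN : 0 < N) : 0 < L N := hc.trans_le (hmin N hN)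
  exact ⟨_, _, fun N => enlargedMeasure.{u} (P N) (W N) (L N), fun N => Prod.fst,
    fun N => truncateRows (P N) (W N) m (L N), fun N => 2 * ε N,
    fun N => hW.isProbabilityMeasure_enlargedMeasure (hL₀ N) (hs N),
    fun N => hW.measurePreserving_fst_enlargedMeasure (hL₀ N) (hs N),
    hW.isWigner_truncateRows hL₀ hs m,
    hW.isRowTruncation_truncateRows hε hε₀ (fun _ => rfl) hL hs hLinε⟩

end RowTruncation

theorem eval_nonneg_of_coeff_nonneg {p : Polynomial ℝ} (hp : ∀ l ≤ p.natDegree, 0 ≤ p.coeff l)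
    {t : ℝ} (ht : 0 ≤ t) : 0 ≤ p.eval t := by
  rw [Polynomial.eval_eq_sum_range]
  exact Finset.sum_nonneg fun l hl =>
    mul_nonneg (hp l (Nat.lt_succ_iff.mp (Finset.mem_range.mp hl))) (pow_nonneg ht l)

theorem pow_le_eval_geom_sum {k n : ℕ} (hk : k < n) {t : ℝ} (ht : 0 ≤ t) :
    t ^ k ≤ (∑ l ∈ Finset.range n, Polynomial.X ^ l : Polynomial ℝ).eval t := by
  simp only [Polynomial.eval_finsetSum, Polynomial.eval_pow, Polynomial.eval_X]
  exact Finset.single_le_sum (f := fun l => t ^ l) (fun l _ => pow_nonneg ht l)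
    (Finset.mem_range.mpr hk)

theorem IsWigner.cVariance_resolventMatrix_le_eval {Ω : ℕ → Type u} [∀ N, MeasurableSpace (Ω N)]
    {P : ∀ N, Measure (Ω N)} [∀ N, IsProbabilityMeasure (P N)]
    {W : ∀ N, Ω N → Matrix (Fin N) (Fin N) ℝ} {σ σ₁ m₄ : ℝ} (hW : IsWigner P W σ σ₁ m₄)
    {N : ℕ} (i j : Fin N) {z : ℂ} (hz : z.im ≠ 0) :
    cVariance (P N) (fun ω => resolventMatrix (W N ω) z i j) ≤
      (48 * (σ ^ 2 + σ₁ ^ 2) + (768 * (σ ^ 2 + σ₁ ^ 2) ^ 2 + 128 * |m₄|)) *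
        ((∫ ω, opNorm (resolventMatrix (W N ω) z) ^ 2 ∂(P N)) *
          (∑ l ∈ Finset.range 5, Polynomial.X ^ l : Polynomial ℝ).eval |z.im|⁻¹ / N) := by
  refine (hW.cVariance_resolventMatrix_le i j hz).trans ?_
  have ht : 0 ≤ |z.im|⁻¹ := inv_nonneg.mpr (abs_nonneg _)
  set t := |z.im|⁻¹
  set Q := ∫ ω, opNorm (resolventMatrix (W N ω) z) ^ 2 ∂(P N)
  set q := (∑ l ∈ Finset.range 5, Polynomial.X ^ l : Polynomial ℝ).eval t
  have h₂ : t ^ 2 ≤ q := pow_le_eval_geom_sum (by norm_num) ht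
  have h₄ : t ^ 4 ≤ q := pow_le_eval_geom_sum (by norm_num) ht
  calc _ ≤ (48 * (σ ^ 2 + σ₁ ^ 2) * q + (768 * (σ ^ 2 + σ₁ ^ 2) ^ 2 + 128 * |m₄|) * q) * Q / N := by
        gcongr
    _ = _ := by ring

end WignerResolvent

theorem proposition3p2_general :
    ∃ P₄ : Polynomial ℝ, P₄.natDegree = 4 ∧ (∀ l ≤ 4, 0 < P₄.coeff l) ∧
      ∀ σ σ₁ m₄ : ℝ, ∃ C : ℝ, 0 < C ∧
        ∀ (m : ℕ) (Ω : ℕ → Type u) [∀ N, MeasurableSpace (Ω N)]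
          (P : ∀ N, Measure (Ω N)) [∀ N, IsProbabilityMeasure (P N)]
          (W : ∀ N, Ω N → Matrix (Fin N) (Fin N) ℝ),
          WignerResolvent.IsWigner P W σ σ₁ m₄ →
          (∀ i < m, ∀ δ > 0, Tendsto (WignerResolvent.rowLindeberg P W i δ) atTop (𝓝 0)) →
          ∃ (Ω' : ℕ → Type u) (_ : ∀ N, MeasurableSpace (Ω' N))
            (P' : ∀ N, Measure (Ω' N)) (π : ∀ N, Ω' N → Ω N)
            (T : ∀ N, Ω' N → Matrix (Fin N) (Fin N) ℝ) (ε : ℕ → ℝ),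
            (∀ N, MeasurePreserving (π N) (P' N) (P N)) ∧
            WignerResolvent.IsRowTruncation P' (fun N ω => W N (π N ω)) T σ m ε ∧
            ∀ (N : ℕ) (i j : Fin N) (z : ℂ), z.im ≠ 0 →
              WignerResolvent.cVariance (P' N)
                  (fun ω => WignerResolvent.resolventMatrix (T N ω) z i j) ≤
                C * ((∫ ω, WignerResolvent.opNorm
                        (WignerResolvent.resolventMatrix (T N ω) z) ^ 2 ∂(P' N)) *
                      P₄.eval (|z.im|⁻¹) / N) := by
  have hdeg : (∑ l ∈ Finset.range 5, Polynomial.X ^ l : Polynomial ℝ).natDegree = 4 := by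
    simp only [Finset.sum_range_succ, Finset.sum_range_zero]
    compute_degree!
  have hcoeff : ∀ l ≤ 4, 0 < (∑ l ∈ Finset.range 5, Polynomial.X ^ l : Polynomial ℝ).coeff l :=
    fun l hl => by simp [Polynomial.coeff_X_pow, Nat.lt_succ_iff.mpr hl]
  refine ⟨_, hdeg, hcoeff, fun σ σ₁ m₄ =>
    ⟨48 * (σ ^ 2 + σ₁ ^ 2) + (768 * (σ ^ 2 + σ₁ ^ 2) ^ 2 + 128 * |4 * m₄|) + 1, by positivity,
      fun m Ω _ P _ W hW hLin => ?_⟩⟩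
  obtain ⟨Ω', mΩ', P', π, T, ε, _, hπ, hT, hTW⟩ := hW.exists_isRowTruncation hLin
  refine ⟨Ω', mΩ', P', π, T, ε, hπ, hTW, fun N i j z hz =>
    (hT.cVariance_resolventMatrix_le_eval i j hz).trans
      (mul_le_mul_of_nonneg_right (le_add_of_nonneg_right zero_le_one) ?_)⟩
  have heval := WignerResolvent.eval_nonneg_of_coeff_nonneg
    (fun l hl => (hcoeff l (hl.trans_eq hdeg)).le) (inv_nonneg.mpr (abs_nonneg z.im))
  positivity

theorem proposition3p2 :
    ∃ P₄ : Polynomial ℝ, P₄.natDegree = 4 ∧ (∀ l ≤ 4, 0 < P₄.coeff l) ∧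
      ∀ σ σ₁ m₄ : ℝ, ∃ C : ℝ, 0 < C ∧
        ∀ (m : ℕ) (Ω : ℕ → Type u) [∀ N, MeasurableSpace (Ω N)]
          (P : ∀ N, Measure (Ω N)) [∀ N, IsProbabilityMeasure (P N)]
          (W : ∀ N, Ω N → Matrix (Fin N) (Fin N) ℝ),
          WignerResolvent.IsWigner P W σ σ₁ m₄ →
          (∀ i < m, ∀ δ > 0, Tendsto (WignerResolvent.rowLindeberg P W i δ) atTop (𝓝 0)) →
          -- the probability spaces may be enlarged, to make room for extra randomness
          ∃ (Ω' : ℕ → Type u) (_ : ∀ N, MeasurableSpace (Ω' N))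
            (P' : ∀ N, Measure (Ω' N)) (π : ∀ N, Ω' N → Ω N)
            (T : ∀ N, Ω' N → Matrix (Fin N) (Fin N) ℝ) (ε : ℕ → ℝ),
            (∀ N, MeasurePreserving (π N) (P' N) (P N)) ∧
            WignerResolvent.IsRowTruncation P' (fun N ω => W N (π N ω)) T σ m ε ∧
            ∀ (N : ℕ) (i j : Fin N), (i : ℕ) < m → ∀ z : ℂ, z.im ≠ 0 →
              WignerResolvent.cVariance (P' N)
                  (fun ω => WignerResolvent.resolventMatrix (T N ω) z i j) ≤
                C * ((∫ ω, WignerResolvent.opNorm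
                        (WignerResolvent.resolventMatrix (T N ω) z) ^ 2 ∂(P' N)) *
                      P₄.eval (|z.im|⁻¹) / N) +
                C * ((∫ ω, WignerResolvent.opNorm
                        (WignerResolvent.resolventMatrix (T N ω) z) ^ (3 / 2 : ℝ) ∂(P' N)) *
                      P₄.eval (|z.im|⁻¹) / N) := by
  obtain ⟨P₄, hdeg, hcoeff, hP₄⟩ := proposition3p2_general.{u}
  refine ⟨P₄, hdeg, hcoeff, fun σ σ₁ m₄ => ?_⟩
  obtain ⟨C, hC, hvar⟩ := hP₄ σ σ₁ m₄
  refine ⟨C, hC, fun m Ω _ P _ W hW hLin => ?_⟩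
  obtain ⟨Ω', mΩ', P', π, T, ε, hπ, hT, hbound⟩ := hvar m Ω P W hW hLin
  refine ⟨Ω', mΩ', P', π, T, ε, hπ, hT, fun N i j _ z hz => ?_⟩
  have hnorm : 0 ≤ ∫ ω, WignerResolvent.opNorm
      (WignerResolvent.resolventMatrix (T N ω) z) ^ (3 / 2 : ℝ) ∂(P' N) :=
    integral_nonneg fun _ => Real.rpow_nonneg (WignerResolvent.opNorm_nonneg _) _
  have heval := WignerResolvent.eval_nonneg_of_coeff_nonneg
    (fun l hl => (hcoeff l (hl.trans_eq hdeg)).le) (inv_nonneg.mpr (abs_nonneg z.im))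
  exact (hbound N i j z hz).trans (le_add_of_nonneg_right (by positivity))
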